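/- Let $I=[0,\alpha)$ with $0<\alpha\le\infty$, and let $L^0$ be the space of Lebesgue measurable functions $f:I\to\mathbb R$. For $f\in L^0$ let $f^*(t)=\inf\{\lambda>0:\ |\{x\in I:|f(x)|>\lambda\}|\le t\}$ be its decreasing rearrangement, and write $g\prec h$ if $\int_0^t g^*\le\int_0^t h^*$ for all $t\in I$. Let $\varphi$ be an $N$-function, that is, $\varphi:[0,\infty)\to[0,\infty)$ is convex and strictly increasing, $\varphi(0)=0$, $\lim_{t\to0+}\varphi(t)/t=0$ and $\lim_{t\to\infty}\varphi(t)/t=\infty$. Let $w$ be a weight on $I$, that is, a positive decreasing (non-increasing) function with $\int_0^t w<\infty$ for every $t\in I$ ($w$ may be unbounded near $0$). Put $$P_{\varphi,w}(f)=\inf\Big\{\int_I\varphi\Big(\frac{f^*}{|g|}\Big)|g| : g\in L^0,\ g\prec w\Big\}\in[0,\infty],\qquad \mathcal M_{\varphi,w}=\{f\in L^0:\ P_{\varphi,w}(f/\lambda)<\infty\text{ for some }\lambda>0\},$$ where $\varphi(u/0)\,0$ is read as $0$ if $u=0$ and as $\infty$ if $u\neq0$. For a non-negative decreasing locally integrable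 $f$ on $I$ and $0\le a<b\le\alpha$ put $R(a,b)=\int_a^b f\big/\int_a^b w$ if $b<\infty$, and $R(a,\infty)=\limsup_{t\to\infty}R(a,t)$ if $b=\alpha=\infty$. The interval $(a,b)$ is a level interval of $f$ (degenerate if $b=\infty$) if $R(a,b)>0$ and $R(a,t)\le R(a,b)$ for all $t\in(a,b)$; it is maximal if it is contained in no larger level interval. The maximal level intervals are pairwise disjoint; let $(a_n,b_n)$ be an enumeration of them. The level function $f^0$ and the inverse level function $w^f$ are $$f^0(t)=\begin{cases}R(a_n,b_n)\,w(t), & t\in(a_n,b_n),\\ f(t), & \text{otherwise,}\end{cases}\qquad w^f(t)=\begin{cases}f(t)/R(a_n,b_n), & t\in(a_n,b_n),\\ w(t), & \text{otherwise.}\end{cases}$$ Then for every $f\in\mathcal M_{\varphi,w}$ with $f=f^*$ a.e. on $I$ and whose support $\{f\ne0\}$ is, up to a null set, a finite interval $(0,s)$, $0\le s<\infty$, $$P_{\varphi,w}(f)=\int_I\varphi\Big(\frac{f^0}{w}\Big)w=\int_I\varphi\Big(\frac{f}{w^f}\Big)w^f,$$ as an identity in $[0,\infty]$. -/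

import Mathlib

open MeasureTheory Filter Set Topology
open scoped ENNReal

noncomputable section

namespace OrliczLorentz

/-- An Orlicz function: a convex, strictly increasing function on `[0, ∞)` vanishing at `0`
(hence non-negative there). The values of `φ` at negative numbers are never used. -/
structure IsOrlicz (φ : ℝ → ℝ) : Prop where
  zero : φ 0 = 0
  convexOn : ConvexOn ℝ (Ici 0) φ
  strictMonoOn : StrictMonoOn φ (Ici 0)

/-- An `N`-function: an Orlicz function with `φ(t)/t → 0` as `t → 0+` and
`φ(t)/t → ∞` as `t → ∞`. -/
structure IsNFunction (φ : ℝ → ℝ) : Prop extends IsOrlicz φ where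
  tendsto_zero : Tendsto (fun t => φ t / t) (𝓝[>] 0) (𝓝 0)
  tendsto_atTop : Tendsto (fun t => φ t / t) atTop atTop

/-- The interval `I = [0, α)`, where `0 < α ≤ ∞`. -/
def I (α : EReal) : Set ℝ := {t | 0 ≤ t ∧ (t : EReal) < α}

/-- Lebesgue measure on `I = [0, α)`. -/
def μ (α : EReal) : Measure ℝ := volume.restrict (I α)

/-- `L⁰`: real functions that are Lebesgue measurable on `I`. -/
def L0 (α : EReal) : Set (ℝ → ℝ) := {f | AEMeasurable f (μ α)}

/-- The distribution function `d_f(c) = μ {t ∈ I : |f t| > c}`. -/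
def distrib (α : EReal) (f : ℝ → ℝ) (c : ℝ) : ℝ≥0∞ := μ α {t | c < |f t|}

/-- The decreasing rearrangement `f*(t) = inf {c > 0 : d_f(c) ≤ t}`, with `inf ∅ = ∞`. -/
def rearr (α : EReal) (f : ℝ → ℝ) (t : ℝ) : ℝ≥0∞ :=
  ⨅ (c : ℝ) (_ : 0 < c ∧ distrib α f c ≤ ENNReal.ofReal t), ENNReal.ofReal c

/-- Submajorization `f ≺ g`: `∫₀ᵗ f* ≤ ∫₀ᵗ g*` for every `t ∈ I`. -/
def Submaj (α : EReal) (f g : ℝ → ℝ) : Prop :=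
  ∀ t ∈ I α, ∫⁻ x in Ioo 0 t, rearr α f x ≤ ∫⁻ x in Ioo 0 t, rearr α g x

/-- A weight on `I`: measurable, positive, decreasing and with `W(t) = ∫₀ᵗ w < ∞` for `t ∈ I`.
Nothing is asked at the point `0`, so that `w` may be unbounded near `0`. -/
structure IsWeight (α : EReal) (w : ℝ → ℝ) : Prop where
  mem_L0 : w ∈ L0 α
  pos : ∀ t ∈ I α, t ≠ 0 → 0 < w t
  antitoneOn : AntitoneOn w (I α \ {0})
  integral_lt_top : ∀ t ∈ I α, ∫⁻ x in Ioo 0 t, ENNReal.ofReal (w x) < ∞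

open Classical in
/-- The expression `φ(u/v) v` for `u, v ∈ [0, ∞]`; for `v = 0` it is `0` if `u = 0` and `∞`
otherwise, and `φ(∞) = ∞`. -/
def persp (φ : ℝ → ℝ) (u v : ℝ≥0∞) : ℝ≥0∞ :=
  if v = 0 then (if u = 0 then 0 else ∞)
  else (if u / v = ∞ then ∞ else ENNReal.ofReal (φ (u / v).toReal)) * v

/-- The modular `P_{φ,w}(f) = inf {∫_I φ(f*/|g|) |g| : g ∈ L⁰, g ≺ w}`. -/
def P (α : EReal) (φ w f : ℝ → ℝ) : ℝ≥0∞ :=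
  ⨅ (g : ℝ → ℝ) (_ : g ∈ L0 α ∧ Submaj α g w),
    ∫⁻ t, persp φ (rearr α f t) (ENNReal.ofReal |g t|) ∂(μ α)

/-- The modular space `M_{φ,w} = {f ∈ L⁰ : P_{φ,w}(f/c) < ∞ for some c > 0}`. -/
def M (α : EReal) (φ w : ℝ → ℝ) : Set (ℝ → ℝ) :=
  {f | f ∈ L0 α ∧ ∃ c : ℝ, 0 < c ∧ P α φ w (fun t => f t / c) < ∞}

/-- `F(a,b) = ∫_a^b f` for a non-negative function `f` and real `a < b`. -/
def intg (f : ℝ → ℝ) (a b : ℝ) : ℝ≥0∞ := ∫⁻ x in Ioo a b, ENNReal.ofReal (f x)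

open Classical in
/-- `R(a,b) = F(a,b)/W(a,b)` for `b < ∞`, and `R(a,∞) = limsup_{t → ∞} R(a,t)`. -/
def R (f w : ℝ → ℝ) (a : ℝ) (b : EReal) : ℝ≥0∞ :=
  if b = ⊤ then limsup (fun t : ℝ => intg f a t / intg w a t) atTop
  else intg f a b.toReal / intg w a b.toReal

/-- `(a, b) ⊆ I` is a level interval of `f` with respect to `w` (a degenerate one if `b = ∞`):
`R(a,t) ≤ R(a,b)` for all `t ∈ (a, b)`, and `R(a,b) > 0`. -/
def IsLevelInterval (α : EReal) (f w : ℝ → ℝ) (a : ℝ) (b : EReal) : Prop :=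
  0 ≤ a ∧ (a : EReal) < b ∧ b ≤ α ∧
    (∀ t : ℝ, a < t → (t : EReal) < b → R f w a t ≤ R f w a b) ∧ 0 < R f w a b

/-- A level interval that is not contained in any larger level interval. -/
def IsMaximalLevelInterval (α : EReal) (f w : ℝ → ℝ) (a : ℝ) (b : EReal) : Prop :=
  IsLevelInterval α f w a b ∧
    ∀ (a' : ℝ) (b' : EReal), IsLevelInterval α f w a' b' → a' ≤ a → b ≤ b' → a' = a ∧ b' = b

/-- `t` lies in the maximal level interval `(p.1, p.2)`. Maximal level intervals are pairwise
disjoint, so that there is at most one such `p`. -/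
def InMaximal (α : EReal) (f w : ℝ → ℝ) (t : ℝ) (p : ℝ × EReal) : Prop :=
  IsMaximalLevelInterval α f w p.1 p.2 ∧ p.1 < t ∧ (t : EReal) < p.2

open Classical in
/-- The level function `f⁰` of a non-negative decreasing `f` with respect to `w`:
`R(a,b) w(t)` if `t` is in the maximal level interval `(a, b)`, and `f(t)` otherwise. -/
def levelFun (α : EReal) (f w : ℝ → ℝ) (t : ℝ) : ℝ≥0∞ :=
  if h : ∃ p, InMaximal α f w t p then R f w h.choose.1 h.choose.2 * ENNReal.ofReal (w t)
  else ENNReal.ofReal (f t)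

open Classical in
/-- The inverse level function `w^f` of `w` with respect to a non-negative decreasing `f`:
`f(t) / R(a,b)` if `t` is in the maximal level interval `(a, b)`, and `w(t)` otherwise. -/
def invLevelFun (α : EReal) (f w : ℝ → ℝ) (t : ℝ) : ℝ≥0∞ :=
  if h : ∃ p, InMaximal α f w t p then ENNReal.ofReal (f t) / R f w h.choose.1 h.choose.2
  else ENNReal.ofReal (w t)

end OrliczLorentz

end

noncomputable section

namespace OrliczLorentz

/-! ### Layer cake formulas for extended non-negative functions -/

/-! Let `F` and `W` be the primitives of `f` and `w` on `(0, s)`, and regard `F` as a function of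
`W`. The slope `h` of its least concave majorant is decreasing and equals `f⁰ / w` a.e.; the maximal
level intervals are those over which the majorant is a chord. The slope is found without building
the majorant: `h t = l` when `t` lies between the smallest and the largest maximizer of `F - l W`
(`exists_slope`, `inMaximal_iff`). Both integrals of the theorem then equal `∫ φ(h) w` over `(0,
s)`.

The main identity is `∫ k(h) f = ∫ k(h) h w` for every `k` (`lintegral_levelSlope_mul`): on a level
interval `h` is a constant `l`, and `F` and `l W` have equal increments; elsewhere `f = h w` a.e.

Lower bound (`lintegral_truncated_le`): for `g ≺ w` the tangent to `φ` at `h`, scaled by `|g|`,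
gives `φ'(h) f ≤ φ(f/|g|) |g| + ψ(h) |g|` with `ψ(c) = c φ'(c) - φ(c)`. As `ψ(h)` is decreasing,
Hardy's lemma replaces `|g|` by `w` in the last integral. The left side integrates to `∫ φ'(h) h w`,
and subtracting `∫ ψ(h) w` leaves `∫ φ(h) w`.

Upper bound: `f / h` on `(0, s)`, continued by `w`, is decreasing and has primitive at most that of
`w`, so it is admissible (`submaj_invSlopeFun`). The main identity with `k(l) = φ(l)/l` shows that
it attains the bound. -/

lemma volume_Ioi_ofReal_lt (u : ℝ≥0∞) :
    volume.restrict (Ioi (0 : ℝ)) {c : ℝ | ENNReal.ofReal c < u} = u := by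
  rw [Measure.restrict_apply' measurableSet_Ioi]
  rcases eq_or_ne u ∞ with rfl | hu
  · simp
  · have : {c : ℝ | ENNReal.ofReal c < u} ∩ Ioi 0 = Ioo 0 u.toReal := by
      ext c
      simp only [mem_inter_iff, mem_ofPred_eq, mem_Ioi, mem_Ioo]
      constructor
      · rintro ⟨h, h0⟩
        exact ⟨h0, (ENNReal.ofReal_lt_iff_lt_toReal h0.le hu).1 h⟩
      · rintro ⟨h0, h⟩
        exact ⟨(ENNReal.ofReal_lt_iff_lt_toReal h0.le hu).2 h, h0⟩
    rw [this, Real.volume_Ioo, sub_zero, ENNReal.ofReal_toReal hu]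

lemma volume_Ioi_ofReal_le (u : ℝ≥0∞) :
    volume.restrict (Ioi (0 : ℝ)) {c : ℝ | ENNReal.ofReal c ≤ u} = u := by
  rw [Measure.restrict_apply' measurableSet_Ioi]
  rcases eq_or_ne u ∞ with rfl | hu
  · simp
  · have : {c : ℝ | ENNReal.ofReal c ≤ u} ∩ Ioi 0 = Ioc 0 u.toReal := by
      ext c
      simp only [mem_inter_iff, mem_ofPred_eq, mem_Ioi, mem_Ioc]
      constructor
      · rintro ⟨h, h0⟩
        exact ⟨h0, (ENNReal.ofReal_le_iff_le_toReal hu).1 h⟩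
      · rintro ⟨h0, h⟩
        exact ⟨(ENNReal.ofReal_le_iff_le_toReal hu).2 h, h0⟩
    rw [this, Real.volume_Ioc, sub_zero, ENNReal.ofReal_toReal hu]

/-- Tonelli on the region `r c (g x)`, whose slice over `x` has length `g x` by `hvol`. The relation
is left abstract so as to cover both `<` and `≤`. -/
lemma lintegral_eq_lintegral_measure_of_rel {X : Type*} [MeasurableSpace X] (ν : Measure X)
    [SFinite ν] (r : ℝ → ℝ≥0∞ → Prop) (hr : MeasurableSet {p : ℝ × ℝ≥0∞ | r p.1 p.2})
    (hvol : ∀ u, volume.restrict (Ioi (0 : ℝ)) {c : ℝ | r c u} = u)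
    {g : X → ℝ≥0∞} (hg : AEMeasurable g ν) :
    ∫⁻ x, g x ∂ν = ∫⁻ c in Ioi (0 : ℝ), ν {x | r c (g x)} := by
  have key : ∀ g : X → ℝ≥0∞, Measurable g →
      ∫⁻ x, g x ∂ν = ∫⁻ c in Ioi (0 : ℝ), ν {x | r c (g x)} := by
    intro g hg
    have hms : MeasurableSet {p : X × ℝ | r p.2 (g p.1)} :=
      hr.preimage (measurable_snd.prodMk (hg.comp measurable_fst))
    have hm : Measurable (Function.uncurry fun (x : X) (c : ℝ) =>
        ({p : X × ℝ | r p.2 (g p.1)}.indicator (fun _ => (1 : ℝ≥0∞)) (x, c))) :=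
      (measurable_const.indicator hms)
    have h1 := lintegral_lintegral_swap (μ := ν) (ν := volume.restrict (Ioi (0 : ℝ)))
      hm.aemeasurable
    have h2 : ∀ x, ∫⁻ c in Ioi (0 : ℝ),
        ({p : X × ℝ | r p.2 (g p.1)}.indicator (fun _ => (1 : ℝ≥0∞)) (x, c)) = g x := by
      intro x
      have hs : MeasurableSet {c : ℝ | r c (g x)} := hms.preimage measurable_prodMk_left
      rw [← hvol (g x), ← lintegral_indicator_one hs]
      exact lintegral_congr fun c => by simp [indicator]
    have h3 : ∀ c : ℝ, ∫⁻ x,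
        ({p : X × ℝ | r p.2 (g p.1)}.indicator (fun _ => (1 : ℝ≥0∞)) (x, c)) ∂ν
          = ν {x | r c (g x)} := by
      intro c
      have hs : MeasurableSet {x | r c (g x)} := hms.preimage measurable_prodMk_right
      rw [← lintegral_indicator_one hs]
      exact lintegral_congr fun c => by simp [indicator]
    simp only [h2, h3] at h1
    exact h1
  rw [lintegral_congr_ae hg.ae_eq_mk, key _ hg.measurable_mk]
  refine lintegral_congr fun c => measure_congr ?_
  filter_upwards [hg.ae_eq_mk] with x hx
  change r c (hg.mk g x) = r c (g x)
  rw [hx]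

/-- Layer cake formula with strict superlevel sets. -/
lemma lintegral_eq_lintegral_ofReal_lt {X : Type*} [MeasurableSpace X] (ν : Measure X)
    [SFinite ν] {g : X → ℝ≥0∞} (hg : AEMeasurable g ν) :
    ∫⁻ x, g x ∂ν = ∫⁻ c in Ioi (0 : ℝ), ν {x | ENNReal.ofReal c < g x} :=
  lintegral_eq_lintegral_measure_of_rel ν (fun c u => ENNReal.ofReal c < u)
    (measurableSet_lt (ENNReal.measurable_ofReal.comp measurable_fst) measurable_snd)
    volume_Ioi_ofReal_lt hg

/-- Layer cake formula with weak superlevel sets. -/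
lemma lintegral_eq_lintegral_ofReal_le {X : Type*} [MeasurableSpace X] (ν : Measure X)
    [SFinite ν] {g : X → ℝ≥0∞} (hg : AEMeasurable g ν) :
    ∫⁻ x, g x ∂ν = ∫⁻ c in Ioi (0 : ℝ), ν {x | ENNReal.ofReal c ≤ g x} :=
  lintegral_eq_lintegral_measure_of_rel ν (fun c u => ENNReal.ofReal c ≤ u)
    (measurableSet_le (ENNReal.measurable_ofReal.comp measurable_fst) measurable_snd)
    volume_Ioi_ofReal_le hg

/-! ### The decreasing rearrangement -/

lemma measurableSet_I (α : EReal) : MeasurableSet (I α) := by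
  refine Set.OrdConnected.measurableSet ⟨fun x hx y hy z hz => ⟨hx.1.trans hz.1, ?_⟩⟩
  exact (EReal.coe_le_coe_iff.2 hz.2).trans_lt hy.2

lemma Ioo_subset_I {α : EReal} {t : ℝ} (ht : (t : EReal) ≤ α) : Ioo 0 t ⊆ I α := fun _ hx =>
  ⟨hx.1.le, (EReal.coe_lt_coe_iff.2 hx.2).trans_le ht⟩

lemma restrict_Ioo_le {α : EReal} {t : ℝ} (ht : (t : EReal) ≤ α) :
    volume.restrict (Ioo 0 t) ≤ μ α :=
  Measure.restrict_mono (Ioo_subset_I ht) le_rfl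

lemma rearr_antitone (α : EReal) (g : ℝ → ℝ) : Antitone (rearr α g) := by
  intro x y hxy
  refine le_iInf₂ fun c hc => iInf₂_le c ⟨hc.1, hc.2.trans (ENNReal.ofReal_le_ofReal hxy)⟩

lemma distrib_antitone (α : EReal) (g : ℝ → ℝ) : Antitone (distrib α g) :=
  fun _ _ hcd => measure_mono fun _ hx => lt_of_le_of_lt hcd hx

/-- With the next lemma, `{rearr > c} ⊆ {x < distrib c} ⊆ {rearr ≥ c}`; this loss of strictness is
why both layer cake formulas are used. -/
lemma le_rearr_of_lt_distrib {α : EReal} {g : ℝ → ℝ} {c x : ℝ}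
    (h : ENNReal.ofReal x < distrib α g c) : ENNReal.ofReal c ≤ rearr α g x := by
  refine le_iInf₂ fun c' hc' => ENNReal.ofReal_le_ofReal ?_
  by_contra! hlt
  exact absurd ((distrib_antitone α g hlt.le).trans hc'.2) (not_le.2 h)

lemma lt_distrib_of_lt_rearr {α : EReal} {g : ℝ → ℝ} {c x : ℝ} (hc : 0 < c)
    (h : ENNReal.ofReal c < rearr α g x) : ENNReal.ofReal x < distrib α g c := by
  by_contra! hle
  exact absurd (iInf₂_le c ⟨hc, hle⟩) (not_le.2 h)

lemma restrict_Ioo_ofReal_lt (t : ℝ) (d : ℝ≥0∞) :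
    volume.restrict (Ioo 0 t) {x : ℝ | ENNReal.ofReal x < d} = min (ENNReal.ofReal t) d := by
  rw [Measure.restrict_apply' measurableSet_Ioo]
  rcases eq_or_ne d ∞ with rfl | hd
  · simp
  · have : {x : ℝ | ENNReal.ofReal x < d} ∩ Ioo 0 t = Ioo 0 (min t d.toReal) := by
      ext x
      simp only [mem_inter_iff, mem_ofPred_eq, mem_Ioo, lt_min_iff]
      constructor
      · rintro ⟨h, h0, h1⟩
        exact ⟨h0, h1, (ENNReal.ofReal_lt_iff_lt_toReal h0.le hd).1 h⟩
      · rintro ⟨h0, h1, h⟩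
        exact ⟨(ENNReal.ofReal_lt_iff_lt_toReal h0.le hd).2 h, h0, h1⟩
    rw [this, Real.volume_Ioo, sub_zero, ENNReal.ofReal_min, ENNReal.ofReal_toReal hd]

/-- Hardy–Littlewood: `∫₀ᵗ |g| ≤ ∫₀ᵗ g*`. -/
lemma lintegral_abs_le_lintegral_rearr {α : EReal} {g : ℝ → ℝ} (hg : g ∈ L0 α) {t : ℝ}
    (ht : (t : EReal) ≤ α) :
    ∫⁻ x in Ioo 0 t, ENNReal.ofReal |g x| ≤ ∫⁻ x in Ioo 0 t, rearr α g x := by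
  have hg' : AEMeasurable g (volume.restrict (Ioo 0 t)) := hg.mono_measure (restrict_Ioo_le ht)
  have hga : AEMeasurable (fun x => |g x|) (volume.restrict (Ioo 0 t)) :=
    continuous_abs.measurable.comp_aemeasurable hg'
  rw [lintegral_eq_lintegral_ofReal_lt _ hga.ennreal_ofReal,
    lintegral_eq_lintegral_ofReal_le _ (rearr_antitone α g).measurable.aemeasurable]
  refine setLIntegral_mono' measurableSet_Ioi fun c hc => ?_
  calc volume.restrict (Ioo 0 t) {x | ENNReal.ofReal c < ENNReal.ofReal |g x|}
      ≤ min (ENNReal.ofReal t) (distrib α g c) := by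
        refine le_min ((measure_mono (subset_univ _)).trans (by simp)) ?_
        refine (restrict_Ioo_le ht _).trans (measure_mono fun x hx => ?_)
        exact lt_of_not_ge fun h => absurd hx (not_lt.2 (ENNReal.ofReal_le_ofReal h))
    _ = volume.restrict (Ioo 0 t) {x : ℝ | ENNReal.ofReal x < distrib α g c} :=
        (restrict_Ioo_ofReal_lt _ _).symm
    _ ≤ _ := measure_mono fun x hx => le_rearr_of_lt_distrib hx

/-- If `g` is non-negative and decreasing on a subset of full measure, `∫₀ᵗ g* ≤ ∫₀ᵗ g`. -/
lemma lintegral_rearr_le_of_antitoneOn {α : EReal} {g : ℝ → ℝ} (hg : g ∈ L0 α) {D : Set ℝ}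
    (hD : ∀ᵐ x ∂(μ α), x ∈ D) (hanti : AntitoneOn g D) (hpos : ∀ x ∈ D, 0 ≤ g x) {t : ℝ}
    (ht : (t : EReal) ≤ α) :
    ∫⁻ x in Ioo 0 t, rearr α g x ≤ ∫⁻ x in Ioo 0 t, ENNReal.ofReal (g x) := by
  have hg' : AEMeasurable g (volume.restrict (Ioo 0 t)) := hg.mono_measure (restrict_Ioo_le ht)
  rw [lintegral_eq_lintegral_ofReal_lt _ hg'.ennreal_ofReal,
    lintegral_eq_lintegral_ofReal_lt _ (rearr_antitone α g).measurable.aemeasurable]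
  refine setLIntegral_mono' measurableSet_Ioi fun c hc => ?_
  have hc : 0 < c := hc
  have hD0 : ∀ᵐ x ∂(μ α), x ∈ D ∧ x ∈ I α ∧ x ≠ 0 := by
    filter_upwards [hD, ae_restrict_mem (measurableSet_I α),
      ae_restrict_of_ae (Measure.ae_ne volume (0 : ℝ))] with x h1 h2 h3 using ⟨h1, h2, h3⟩
  have hDt : ∀ᵐ x ∂(volume.restrict (Ioo 0 t)), x ∈ D :=
    ae_mono (restrict_Ioo_le ht) hD
  calc volume.restrict (Ioo 0 t) {x | ENNReal.ofReal c < rearr α g x}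
      ≤ volume.restrict (Ioo 0 t) {x : ℝ | ENNReal.ofReal x < distrib α g c} :=
        measure_mono fun x hx => lt_distrib_of_lt_rearr hc hx
    _ = min (ENNReal.ofReal t) (distrib α g c) := restrict_Ioo_ofReal_lt _ _
    _ ≤ _ := ?_
  -- If `g` drops to `c` at some `y < t`, its superlevel set lies a.e. in `(0, t)`; otherwise that
  -- set fills `(0, t)` up to a null set.
  by_cases hcase : ∃ y ∈ D, y ∈ Ioo 0 t ∧ g y ≤ c
  · obtain ⟨y, hyD, hyt, hyc⟩ := hcase
    refine (min_le_right _ _).trans ?_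
    have h1 : distrib α g c ≤ μ α ({x | ENNReal.ofReal c < ENNReal.ofReal (g x)} ∩ Ioo 0 t) := by
      refine measure_mono_ae ?_
      filter_upwards [hD0] with x hx hxc
      have hxc : c < |g x| := hxc
      rw [abs_of_nonneg (hpos x hx.1)] at hxc
      refine ⟨(ENNReal.ofReal_lt_ofReal_iff (hc.trans hxc)).2 hxc,
        lt_of_le_of_ne hx.2.1.1 hx.2.2.symm, ?_⟩
      by_contra! hle
      exact absurd (hanti hyD hx.1 (hyt.2.le.trans hle)) (not_le.2 (hyc.trans_lt hxc))
    refine h1.trans ?_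
    rw [Measure.restrict_apply' measurableSet_Ioo]
    exact Measure.restrict_apply_le _ _
  · push Not at hcase
    refine (min_le_left _ _).trans ?_
    have h1 : volume.restrict (Ioo 0 t) (Ioo 0 t) ≤
        volume.restrict (Ioo 0 t) {x | ENNReal.ofReal c < ENNReal.ofReal (g x)} := by
      refine measure_mono_ae ?_
      filter_upwards [hDt] with x hx hxt
      have := hcase x hx hxt
      exact (ENNReal.ofReal_lt_ofReal_iff (hc.trans this)).2 this
    simpa using h1

/-! ### Hardy's lemma -/

/-- Monotone convergence along `(0, τ n)`. It reaches the endpoint `s = α`, which is outside `I` and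
thus not covered by submajorization. -/
lemma setLIntegral_Ioo_le_of_forall_lt {u v : ℝ → ℝ≥0∞} {s : ℝ}
    (h : ∀ t ∈ Ioo 0 s, ∫⁻ x in Ioo 0 t, u x ≤ ∫⁻ x in Ioo 0 t, v x) :
    ∫⁻ x in Ioo 0 s, u x ≤ ∫⁻ x in Ioo 0 s, v x := by
  rcases le_or_gt s 0 with hs | hs
  · simp [Ioo_eq_empty (not_lt.2 hs)]
  obtain ⟨τ, hmono, hτ, hlim⟩ := exists_seq_strictMono_tendsto' hs
  have hU : ⋃ n, Ioo 0 (τ n) = Ioo 0 s := by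
    ext x
    simp only [mem_iUnion, mem_Ioo]
    constructor
    · rintro ⟨n, h0, h1⟩
      exact ⟨h0, h1.trans (hτ n).2⟩
    · rintro ⟨h0, h1⟩
      obtain ⟨n, hn⟩ := (hlim.eventually (lt_mem_nhds h1)).exists
      exact ⟨n, h0, hn⟩
  have hdir : Directed (· ⊆ ·) fun n => Ioo 0 (τ n) :=
    (monotone_nat_of_le_succ fun n => Ioo_subset_Ioo_right (hmono n.lt_succ_self).le).directed_le
  rw [← hU, setLIntegral_iUnion_of_directed _ hdir, setLIntegral_iUnion_of_directed _ hdir]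
  exact iSup_mono fun n => h _ (hτ n)

/-- Hardy's lemma: if `∫₀ᵗ u ≤ ∫₀ᵗ v` for `t < s` then `∫₀ˢ k u ≤ ∫₀ˢ k v` for decreasing `k`. -/
lemma lintegral_mul_le_of_antitoneOn {u v k : ℝ → ℝ≥0∞} {s : ℝ}
    (hu : AEMeasurable u (volume.restrict (Ioo 0 s)))
    (hv : AEMeasurable v (volume.restrict (Ioo 0 s)))
    (hk : AntitoneOn k (Ioo 0 s))
    (h : ∀ t ∈ Ioo 0 s, ∫⁻ x in Ioo 0 t, u x ≤ ∫⁻ x in Ioo 0 t, v x) :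
    ∫⁻ x in Ioo 0 s, k x * u x ≤ ∫⁻ x in Ioo 0 s, k x * v x := by
  have hkm : AEMeasurable k (volume.restrict (Ioo 0 s)) :=
    aemeasurable_restrict_of_antitoneOn measurableSet_Ioo hk
  have key : ∀ {v : ℝ → ℝ≥0∞}, AEMeasurable v (volume.restrict (Ioo 0 s)) →
      ∫⁻ x in Ioo 0 s, k x * v x = ∫⁻ c in Ioi (0 : ℝ),
        ∫⁻ x in {x | ENNReal.ofReal c < k x} ∩ Ioo 0 s, v x := by
    intro v hv
    -- Layer cake for `k` with respect to the measure of density `v`.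
    have h1 := lintegral_withDensity_eq_lintegral_mul₀ hv hkm
    simp only [Pi.mul_apply] at h1
    simp_rw [mul_comm (k _), ← h1]
    rw [lintegral_eq_lintegral_ofReal_lt _ (hkm.mono_ac (withDensity_absolutelyContinuous _ _))]
    refine lintegral_congr fun c => ?_
    rw [withDensity_apply', Measure.restrict_restrict' measurableSet_Ioo]
  rw [key hu, key hv]
  refine lintegral_mono fun c => ?_
  set E := {x | ENNReal.ofReal c < k x} ∩ Ioo 0 s with hE
  rcases E.eq_empty_or_nonempty with h0 | ⟨x₀, hx₀⟩
  · simp [h0]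
  have hbdd : BddAbove E := ⟨s, fun x hx => hx.2.2.le⟩
  have hT0 : 0 < sSup E := hx₀.2.1.trans_le (le_csSup hbdd hx₀)
  have hTs : sSup E ≤ s := csSup_le ⟨x₀, hx₀⟩ fun x hx => hx.2.2.le
  -- A superlevel set of a decreasing function is an initial interval up to its right endpoint, so
  -- the hypothesis on primitives applies to it.
  have hEq : E =ᵐ[volume] Ioo 0 (sSup E) := by
    have hsub1 : Ioo 0 (sSup E) ⊆ E := by
      intro x hx
      obtain ⟨y, hy, hxy⟩ := exists_lt_of_lt_csSup ⟨x₀, hx₀⟩ hx.2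
      have hxs : x ∈ Ioo 0 s := ⟨hx.1, hx.2.trans_le hTs⟩
      exact ⟨lt_of_lt_of_le hy.1 (hk hxs hy.2 hxy.le), hxs⟩
    have hsub2 : E ⊆ Ioc 0 (sSup E) := fun x hx => ⟨hx.2.1, le_csSup hbdd hx⟩
    exact (hsub2.eventuallyLE.trans Ioo_ae_eq_Ioc.symm.le).antisymm hsub1.eventuallyLE
  rw [setLIntegral_congr hEq, setLIntegral_congr hEq]
  exact setLIntegral_Ioo_le_of_forall_lt fun t ht => h t ⟨ht.1, ht.2.trans_le hTs⟩

/-! ### Tangent lines of Orlicz functions and the perspective function -/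

/-- The right derivative of `φ`. -/
def rderiv (φ : ℝ → ℝ) (c : ℝ) : ℝ := derivWithin φ (Ioi c) c

/-- Minus the value at `0` of the tangent line to `φ` at `c`. -/
def conj (φ : ℝ → ℝ) (c : ℝ) : ℝ := c * rderiv φ c - φ c

namespace IsOrlicz

variable {φ : ℝ → ℝ}

lemma nonneg (hφ : IsOrlicz φ) {x : ℝ} (hx : 0 ≤ x) : 0 ≤ φ x := by
  simpa [hφ.zero] using hφ.strictMonoOn.monotoneOn self_mem_Ici hx hx

lemma pos (hφ : IsOrlicz φ) {x : ℝ} (hx : 0 < x) : 0 < φ x := by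
  simpa [hφ.zero] using hφ.strictMonoOn self_mem_Ici hx.le hx

lemma tangent_le (hφ : IsOrlicz φ) {c x : ℝ} (hc : 0 < c) (hx : 0 ≤ x) :
    φ c + rderiv φ c * (x - c) ≤ φ x := by
  have hci : c ∈ interior (Ici (0 : ℝ)) := by rwa [interior_Ici]
  rcases lt_trichotomy x c with h | rfl | h
  · have h1 := (hφ.convexOn.slope_le_leftDeriv_of_mem_interior hx hci h).trans
      (hφ.convexOn.leftDeriv_le_rightDeriv_of_mem_interior hci)
    rw [slope_def_field, div_le_iff₀ (by linarith)] at h1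
    unfold rderiv
    nlinarith
  · simp
  · have h1 := hφ.convexOn.rightDeriv_le_slope_of_mem_interior hci hx h
    rw [slope_def_field, le_div_iff₀ (by linarith)] at h1
    unfold rderiv
    linarith

lemma rderiv_monotoneOn (hφ : IsOrlicz φ) : MonotoneOn (rderiv φ) (Ioi 0) := by
  have h := hφ.convexOn.monotoneOn_rightDeriv
  rwa [interior_Ici] at h

lemma conj_nonneg (hφ : IsOrlicz φ) {c : ℝ} (hc : 0 < c) : 0 ≤ conj φ c := by
  have := hφ.tangent_le hc le_rfl
  rw [hφ.zero] at this
  unfold conj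
  linarith

lemma rderiv_pos (hφ : IsOrlicz φ) {c : ℝ} (hc : 0 < c) : 0 < rderiv φ c := by
  have h1 := hφ.conj_nonneg hc
  have h2 := hφ.pos hc
  unfold conj at h1
  exact pos_of_mul_pos_right (by linarith) hc.le

/-- The tangent at `d`, evaluated at `c ≤ d`, gives `conj φ d ≥ c φ'(d) - φ c ≥ conj φ c`.
Monotonicity makes `conj φ` of a decreasing function a legitimate factor in Hardy's lemma. -/
lemma conj_monotoneOn (hφ : IsOrlicz φ) : MonotoneOn (conj φ) (Ioi 0) := by
  intro c hc d hd hcd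
  have h1 := hφ.tangent_le hd (le_of_lt hc)
  have h2 := mul_le_mul_of_nonneg_left (hφ.rderiv_monotoneOn hc hd hcd) (le_of_lt hc)
  unfold conj
  linarith

/-- The tangent plane inequality for the perspective function. -/
lemma rderiv_mul_le_persp_add (hφ : IsOrlicz φ) {c : ℝ} (hc : 0 < c) (u : ℝ≥0∞) {v : ℝ≥0∞}
    (hv : v ≠ ∞) :
    ENNReal.ofReal (rderiv φ c) * u ≤ persp φ u v + ENNReal.ofReal (conj φ c) * v := by
  unfold persp
  split_ifs with hv0 hu huv
  · simp [hu]
  · simp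
  · simp [hv0]
  · have hu : u ≠ ∞ := by
      rintro rfl
      exact huv (ENNReal.top_div_of_ne_top hv)
    lift u to NNReal using hu
    lift v to NNReal using hv
    have hvpos : (0 : ℝ) < v := by
      have : v ≠ 0 := by simpa using hv0
      positivity
    have h1 := hφ.tangent_le hc (x := (u : ℝ) / v) (by positivity)
    have h2 : ((u : ℝ≥0∞) / v).toReal = (u : ℝ) / v := by simp
    rw [h2, ← ENNReal.ofReal_coe_nnreal (p := u), ← ENNReal.ofReal_coe_nnreal (p := v),
      ← ENNReal.ofReal_mul (hφ.rderiv_pos hc).le, ← ENNReal.ofReal_mul (hφ.nonneg (by positivity)),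
      ← ENNReal.ofReal_mul (hφ.conj_nonneg hc), ← ENNReal.ofReal_add
        (mul_nonneg (hφ.nonneg (by positivity)) hvpos.le)
        (mul_nonneg (hφ.conj_nonneg hc) hvpos.le)]
    refine ENNReal.ofReal_le_ofReal ?_
    have h3 := mul_le_mul_of_nonneg_right h1 hvpos.le
    have h4 : (φ c + rderiv φ c * (u / v - c)) * v
        = rderiv φ c * u - conj φ c * v := by
      unfold conj
      field_simp
      ring
    linarith

end IsOrlicz

lemma persp_ofReal {φ : ℝ → ℝ} {u v : ℝ} (hu : 0 ≤ u) (hv : 0 < v) :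
    persp φ (ENNReal.ofReal u) (ENNReal.ofReal v)
      = ENNReal.ofReal (φ (u / v)) * ENNReal.ofReal v := by
  have hv0 : ENNReal.ofReal v ≠ 0 := by simpa using hv
  have h1 : ENNReal.ofReal u / ENNReal.ofReal v = ENNReal.ofReal (u / v) :=
    (ENNReal.ofReal_div_of_pos hv).symm
  rw [persp, if_neg hv0, h1, if_neg ENNReal.ofReal_ne_top,
    ENNReal.toReal_ofReal (div_nonneg hu hv.le)]

/-! ### Maximizers of `F - l W` -/

/-- The points of `[0, s]` at which `F - l W` is maximal. -/
def maximizers (F W : ℝ → ℝ) (s l : ℝ) : Set ℝ :=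
  {x | x ∈ Icc 0 s ∧ ∀ y ∈ Icc 0 s, F y - l * W y ≤ F x - l * W x}

/-- The smallest maximizer of `F - l W` on `[0, s]`. -/
def lo (F W : ℝ → ℝ) (s l : ℝ) : ℝ := sInf (maximizers F W s l)

/-- The largest maximizer of `F - l W` on `[0, s]`. -/
def hi (F W : ℝ → ℝ) (s l : ℝ) : ℝ := sSup (maximizers F W s l)

/-- The graph of `F` as a function of `W` lies below its chord over `(a, b)`. -/
def IsChord (F W : ℝ → ℝ) (a b : ℝ) : Prop :=
  ∀ t, a < t → t < b → (F t - F a) * (W b - W a) ≤ (F b - F a) * (W t - W a)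

/-- Continuous functions that are strictly increasing on `[0, s]`. -/
structure IsPrimitivePair (F W : ℝ → ℝ) (s : ℝ) : Prop where
  continuous_left : Continuous F
  continuous_right : Continuous W
  strictMonoOn_left : StrictMonoOn F (Icc 0 s)
  strictMonoOn_right : StrictMonoOn W (Icc 0 s)

open Classical in
/-- The slope at `t` of the least concave majorant of `F` as a function of `W`; it is `0` outside
`(0, s)`. -/
def majSlope (F W : ℝ → ℝ) (s t : ℝ) : ℝ :=
  if h : t ∈ Ioo 0 s ∧ ∃ l, 0 < l ∧ lo F W s l ≤ t ∧ t ≤ hi F W s l then h.2.choose else 0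

namespace IsPrimitivePair

variable {F W : ℝ → ℝ} {s : ℝ}

lemma isCompact_maximizers (h : IsPrimitivePair F W s) (l : ℝ) :
    IsCompact (maximizers F W s l) := by
  have hG : Continuous fun x => F x - l * W x :=
    h.continuous_left.sub (continuous_const.mul h.continuous_right)
  have : maximizers F W s l
      = Icc 0 s ∩ ⋂ y ∈ Icc 0 s, {x | F y - l * W y ≤ F x - l * W x} := by
    ext x
    simp [maximizers]
  rw [this]
  exact isCompact_Icc.inter_right
    (isClosed_biInter fun y _ => isClosed_le continuous_const hG)

lemma maximizers_nonempty (h : IsPrimitivePair F W s) (hs : 0 < s) (l : ℝ) :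
    (maximizers F W s l).Nonempty := by
  have hG : Continuous fun x => F x - l * W x :=
    h.continuous_left.sub (continuous_const.mul h.continuous_right)
  obtain ⟨x, hx, hmax⟩ := isCompact_Icc.exists_isMaxOn (nonempty_Icc.2 hs.le) hG.continuousOn
  exact ⟨x, hx, fun y hy => hmax hy⟩

lemma lo_mem (h : IsPrimitivePair F W s) (hs : 0 < s) (l : ℝ) :
    lo F W s l ∈ maximizers F W s l :=
  (h.isCompact_maximizers l).sInf_mem (h.maximizers_nonempty hs l)

lemma hi_mem (h : IsPrimitivePair F W s) (hs : 0 < s) (l : ℝ) :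
    hi F W s l ∈ maximizers F W s l :=
  (h.isCompact_maximizers l).sSup_mem (h.maximizers_nonempty hs l)

lemma lo_le (h : IsPrimitivePair F W s) {l x : ℝ} (hx : x ∈ maximizers F W s l) :
    lo F W s l ≤ x :=
  csInf_le (h.isCompact_maximizers l).bddBelow hx

lemma le_hi (h : IsPrimitivePair F W s) {l x : ℝ} (hx : x ∈ maximizers F W s l) :
    x ≤ hi F W s l :=
  le_csSup (h.isCompact_maximizers l).bddAbove hx

/-- Adding the two optimality inequalities gives `(l' - l) (W x' - W x) ≤ 0`. Hence the intervals
`[lo l, hi l]` move left as `l` grows and overlap at most in endpoints. -/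
lemma maximizers_le_of_lt (h : IsPrimitivePair F W s) {l l' x x' : ℝ} (hl : l < l')
    (hx : x ∈ maximizers F W s l) (hx' : x' ∈ maximizers F W s l') : x' ≤ x := by
  by_contra! hlt
  have h1 := hx.2 x' hx'.1
  have h2 := hx'.2 x hx.1
  have h3 := h.strictMonoOn_right hx.1 hx'.1 hlt
  nlinarith

lemma hi_le_lo_of_lt (h : IsPrimitivePair F W s) (hs : 0 < s) {l l' : ℝ} (hl : l < l') :
    hi F W s l' ≤ lo F W s l :=
  h.maximizers_le_of_lt hl (h.lo_mem hs l) (h.hi_mem hs l')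

/-- Compare the maxima of `F - l W` over `[0, t]` and over `[t, s]`. Their difference is continuous
in `l` and changes sign; at a zero there are maximizers on both sides of `t`. -/
lemma exists_slope (h : IsPrimitivePair F W s) {t : ℝ} (ht : t ∈ Ioo 0 s) :
    ∃ l, 0 < l ∧ lo F W s l ≤ t ∧ t ≤ hi F W s l := by
  have hs : 0 < s := ht.1.trans ht.2
  have hsI : s ∈ Icc 0 s := ⟨hs.le, le_rfl⟩
  have h0I : (0 : ℝ) ∈ Icc 0 s := ⟨le_rfl, hs.le⟩
  have htI : t ∈ Icc 0 s := ⟨ht.1.le, ht.2.le⟩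
  have hc : Continuous (Function.uncurry fun l x => F x - l * W x) :=
    (h.continuous_left.comp continuous_snd).sub
      (continuous_fst.mul (h.continuous_right.comp continuous_snd))
  have hG : ∀ l, Continuous fun x => F x - l * W x := fun l =>
    h.continuous_left.sub (continuous_const.mul h.continuous_right)
  set m₁ : ℝ → ℝ := fun l => sSup ((fun x => F x - l * W x) '' Icc 0 t) with hm₁
  set m₂ : ℝ → ℝ := fun l => sSup ((fun x => F x - l * W x) '' Icc t s) with hm₂
  have hc₁ : Continuous m₁ := isCompact_Icc.continuous_sSup hc
  have hc₂ : Continuous m₂ := isCompact_Icc.continuous_sSup hc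
  have hatt : ∀ {p q : ℝ}, p ≤ q → ∀ l, ∃ x ∈ Icc p q,
      sSup ((fun x => F x - l * W x) '' Icc p q) = F x - l * W x ∧
      ∀ y ∈ Icc p q, F y - l * W y ≤ F x - l * W x := fun hpq l =>
    isCompact_Icc.exists_sSup_image_eq_and_ge (nonempty_Icc.2 hpq) (hG l).continuousOn
  have hzero : m₁ 0 ≤ m₂ 0 := by
    obtain ⟨x, hx, hxe, -⟩ := hatt ht.1.le 0
    obtain ⟨y, hy, hye, hyM⟩ := hatt ht.2.le 0
    have h1 := hyM t ⟨le_rfl, ht.2.le⟩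
    have h2 := h.strictMonoOn_left.monotoneOn ⟨hx.1, hx.2.trans ht.2.le⟩ htI hx.2
    simp only [hm₁, hm₂, hxe, hye]
    linarith
  have hW : 0 < W t - W 0 := sub_pos.2 (h.strictMonoOn_right h0I htI ht.1)
  have hF : 0 < F s - F 0 := sub_pos.2 (h.strictMonoOn_left h0I hsI hs)
  -- For this `L` the value of `F - L W` at `0` already dominates its values on `[t, s]`.
  set L := (F s - F 0) / (W t - W 0) with hL
  have hL0 : 0 < L := div_pos hF hW
  have hLe : m₂ L ≤ m₁ L := by
    obtain ⟨x, hx, hxe, hxM⟩ := hatt ht.1.le L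
    obtain ⟨y, hy, hye, -⟩ := hatt ht.2.le L
    have h1 := hxM 0 ⟨le_rfl, ht.1.le⟩
    have hyI : y ∈ Icc 0 s := ⟨ht.1.le.trans hy.1, hy.2⟩
    have h2 := h.strictMonoOn_left.monotoneOn hyI hsI hy.2
    have h3 := h.strictMonoOn_right.monotoneOn htI hyI hy.1
    have h4 : L * (W t - W 0) = F s - F 0 := div_mul_cancel₀ _ hW.ne'
    have h5 := mul_le_mul_of_nonneg_left h3 hL0.le
    simp only [hm₁, hm₂, hxe, hye]
    linarith
  obtain ⟨l, hl, hle⟩ := intermediate_value_Icc hL0.le (hc₁.sub hc₂).continuousOn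
    (⟨by simpa using hzero, by simpa using hLe⟩ :
      (0 : ℝ) ∈ Icc ((m₁ - m₂) 0) ((m₁ - m₂) L))
  have heq : m₁ l = m₂ l := sub_eq_zero.1 hle
  obtain ⟨x, hx, hxe, hxM⟩ := hatt ht.1.le l
  obtain ⟨y, hy, hye, hyM⟩ := hatt ht.2.le l
  have hxy : F x - l * W x = F y - l * W y := by
    rw [← hxe, ← hye]
    exact heq
  have hmax : ∀ z ∈ Icc 0 s, F z - l * W z ≤ F x - l * W x := by
    intro z hz
    rcases le_total z t with hzt | hzt
    · exact hxM z ⟨hz.1, hzt⟩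
    · rw [hxy]
      exact hyM z ⟨hzt, hz.2⟩
  have hxm : x ∈ maximizers F W s l := ⟨⟨hx.1, hx.2.trans ht.2.le⟩, hmax⟩
  have hym : y ∈ maximizers F W s l :=
    ⟨⟨ht.1.le.trans hy.1, hy.2⟩, fun z hz => by rw [← hxy]; exact hmax z hz⟩
  refine ⟨l, lt_of_le_of_ne hl.1 ?_, (h.lo_le hxm).trans hx.2, hy.1.trans (h.le_hi hym)⟩
  -- For `l = 0` the maximizer `x ≤ t < s` would contradict the strict increase of `F`.
  rintro rfl
  have h1 := hmax s hsI
  have h2 := h.strictMonoOn_left hxm.1 hsI (hx.2.trans_lt ht.2)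
  linarith

lemma majSlope_spec (h : IsPrimitivePair F W s) {t : ℝ} (ht : t ∈ Ioo 0 s) :
    0 < majSlope F W s t ∧ lo F W s (majSlope F W s t) ≤ t ∧ t ≤ hi F W s (majSlope F W s t) := by
  have hex : t ∈ Ioo 0 s ∧ ∃ l, 0 < l ∧ lo F W s l ≤ t ∧ t ≤ hi F W s l :=
    ⟨ht, h.exists_slope ht⟩
  rw [majSlope, dif_pos hex]
  exact hex.2.choose_spec

lemma majSlope_antitoneOn (h : IsPrimitivePair F W s) :
    AntitoneOn (majSlope F W s) (Ioo 0 s) := by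
  intro t ht t' ht' htt'
  rcases htt'.eq_or_lt with rfl | hlt
  · exact le_rfl
  by_contra! hl
  have h1 := h.hi_le_lo_of_lt (ht.1.trans ht.2) hl
  linarith [(h.majSlope_spec ht).2.1, (h.majSlope_spec ht').2.2]

/-- By the ordering of the intervals `[lo l, hi l]`, the slope is unique at interior points. At an
endpoint several `l` may qualify, hence the strict inequalities. -/
lemma majSlope_eq (h : IsPrimitivePair F W s) {t l : ℝ} (ht : t ∈ Ioo 0 s)
    (h1 : lo F W s l < t) (h2 : t < hi F W s l) : majSlope F W s t = l := by
  have hs := ht.1.trans ht.2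
  rcases lt_trichotomy (majSlope F W s t) l with hl | hl | hl
  · linarith [h.hi_le_lo_of_lt hs hl, (h.majSlope_spec ht).2.1]
  · exact hl
  · linarith [h.hi_le_lo_of_lt hs hl, (h.majSlope_spec ht).2.2]

lemma sub_lo_hi (h : IsPrimitivePair F W s) (hs : 0 < s) (l : ℝ) :
    F (hi F W s l) - F (lo F W s l) = l * (W (hi F W s l) - W (lo F W s l)) := by
  have h1 := (h.lo_mem hs l).2 _ (h.hi_mem hs l).1
  have h2 := (h.hi_mem hs l).2 _ (h.lo_mem hs l).1
  linarith

lemma sub_lo_le (h : IsPrimitivePair F W s) (hs : 0 < s) (l : ℝ) {x : ℝ} (hx : x ∈ Icc 0 s) :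
    F x - F (lo F W s l) ≤ l * (W x - W (lo F W s l)) := by
  linarith [(h.lo_mem hs l).2 x hx]

lemma le_hi_sub (h : IsPrimitivePair F W s) (hs : 0 < s) (l : ℝ) {x : ℝ} (hx : x ∈ Icc 0 s) :
    l * (W (hi F W s l) - W x) ≤ F (hi F W s l) - F x := by
  linarith [(h.hi_mem hs l).2 x hx]

lemma isChord_lo_hi (h : IsPrimitivePair F W s) (hs : 0 < s) (l : ℝ) :
    IsChord F W (lo F W s l) (hi F W s l) := by
  intro t h1 h2
  have hlo := (h.lo_mem hs l).1
  have hhi := (h.hi_mem hs l).1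
  have htI : t ∈ Icc 0 s := ⟨hlo.1.trans h1.le, h2.le.trans hhi.2⟩
  rw [h.sub_lo_hi hs l]
  have h3 := h.sub_lo_le hs l htI
  have h4 := h.strictMonoOn_right hlo hhi (h1.trans h2)
  nlinarith

/-- A chord over an interval that meets `[lo l, hi l]` lies inside `[lo l, hi l]`. -/
lemma lo_le_and_le_hi_of_isChord (h : IsPrimitivePair F W s) {a b t l : ℝ} (ha : 0 ≤ a)
    (hb : b ≤ s) (hc : IsChord F W a b) (hat : a < t) (htb : t < b) (hl : lo F W s l ≤ t)
    (hu : t ≤ hi F W s l) : lo F W s l ≤ a ∧ b ≤ hi F W s l := by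
  have hs : 0 < s := ha.trans_lt (hat.trans (htb.trans_le hb))
  have haI : a ∈ Icc 0 s := ⟨ha, (hat.trans htb).le.trans hb⟩
  have hbI : b ∈ Icc 0 s := ⟨ha.trans (hat.trans htb).le, hb⟩
  have hab := h.strictMonoOn_right haI hbI (hat.trans htb)
  constructor
  · by_contra! hlt
    have hmem := h.lo_mem hs l
    set c := lo F W s l
    -- Let `G = F - l W`. The chord bounds `G c` by an average of `G a` and `G b` with positive
    -- weights, but `G c ≥ G b`, and `G c > G a` because `c` is the smallest maximizer.
    have h1 := hc c hlt (hl.trans_lt htb)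
    have h2 : F a - l * W a < F c - l * W c := by
      by_contra! hle
      have : a ∈ maximizers F W s l := ⟨haI, fun y hy => (hmem.2 y hy).trans hle⟩
      exact absurd (h.lo_le this) (not_le.2 hlt)
    have h3 := hmem.2 b hbI
    have h4 := h.strictMonoOn_right haI hmem.1 hlt
    have h5 := h.strictMonoOn_right hmem.1 hbI (hl.trans_lt htb)
    nlinarith
  · by_contra! hlt
    have hmem := h.hi_mem hs l
    set c := hi F W s l
    have h1 := hc c (hat.trans_le hu) hlt
    have h2 : F b - l * W b < F c - l * W c := by
      by_contra! hle
      have : b ∈ maximizers F W s l := ⟨hbI, fun y hy => (hmem.2 y hy).trans hle⟩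
      exact absurd (h.le_hi this) (not_le.2 hlt)
    have h3 := hmem.2 a haI
    have h4 := h.strictMonoOn_right haI hmem.1 (hat.trans_le hu)
    have h5 := h.strictMonoOn_right hmem.1 hbI hlt
    nlinarith

/-- At a maximizer in `(0, s)` the derivatives satisfy `F' = l W'`. -/
lemma hasDerivAt_eq_of_mem_maximizers {t l p q : ℝ} (ht : t ∈ Ioo 0 s)
    (hm : t ∈ maximizers F W s l) (hF : HasDerivAt F p t) (hW : HasDerivAt W q t) :
    p = l * q := by
  have hmax : IsLocalMax (fun x => F x - l * W x) t := by
    filter_upwards [Icc_mem_nhds ht.1 ht.2] with y hy using hm.2 y hy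
  have := hmax.hasDerivAt_eq_zero (hF.sub (hW.const_mul l))
  linarith

end IsPrimitivePair

/-! ### Primitives -/

/-- The primitive `∫₀ᵗ u` of the restriction of `u` to `(0, s)`. -/
def prim (u : ℝ → ℝ) (s t : ℝ) : ℝ := ∫ x in (0 : ℝ)..t, (Ioo 0 s).indicator u x

/-- `u` is measurable, a.e. positive and integrable on `(0, s)`. -/
structure PosIntegrable (u : ℝ → ℝ) (s : ℝ) : Prop where
  aemeasurable : AEMeasurable u (volume.restrict (Ioo 0 s))
  pos : ∀ᵐ x ∂(volume.restrict (Ioo 0 s)), 0 < u x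
  lt_top : intg u 0 s < ∞

namespace PosIntegrable

variable {u : ℝ → ℝ} {s : ℝ}

lemma integrableOn (h : PosIntegrable u s) : IntegrableOn u (Ioo 0 s) := by
  refine ⟨h.aemeasurable.aestronglyMeasurable, ?_⟩
  rw [hasFiniteIntegral_iff_ofReal (h.pos.mono fun x hx => hx.le)]
  exact h.lt_top

lemma integrable_indicator (h : PosIntegrable u s) : Integrable ((Ioo 0 s).indicator u) :=
  h.integrableOn.integrable_indicator measurableSet_Ioo

lemma continuous_prim (h : PosIntegrable u s) : Continuous (prim u s) :=
  intervalIntegral.continuous_primitive (fun _ _ => h.integrable_indicator.intervalIntegrable) 0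

lemma prim_sub (h : PosIntegrable u s) {a b : ℝ} (ha : 0 ≤ a) (hab : a ≤ b) (hb : b ≤ s) :
    prim u s b - prim u s a = ∫ x in Ioo a b, u x := by
  unfold prim
  rw [intervalIntegral.integral_interval_sub_left h.integrable_indicator.intervalIntegrable
    h.integrable_indicator.intervalIntegrable, intervalIntegral.integral_of_le hab,
    integral_Ioc_eq_integral_Ioo]
  exact setIntegral_congr_fun measurableSet_Ioo fun x hx =>
    indicator_of_mem (Ioo_subset_Ioo ha hb hx) u

lemma prim_sub_le (h : PosIntegrable u s) {a b C : ℝ} (ha : 0 ≤ a) (hab : a ≤ b) (hb : b ≤ s)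
    (hC : ∀ᵐ x, x ∈ Ioo a b → u x ≤ C) : prim u s b - prim u s a ≤ C * (b - a) := by
  rw [h.prim_sub ha hab hb]
  refine (setIntegral_mono_on_ae (h.integrableOn.mono_set (Ioo_subset_Ioo ha hb))
    (integrableOn_const (by simp)) measurableSet_Ioo hC).trans_eq ?_
  rw [setIntegral_const, Real.volume_real_Ioo_of_le hab, smul_eq_mul, mul_comm]

lemma le_prim_sub (h : PosIntegrable u s) {a b C : ℝ} (ha : 0 ≤ a) (hab : a ≤ b) (hb : b ≤ s)
    (hC : ∀ᵐ x, x ∈ Ioo a b → C ≤ u x) : C * (b - a) ≤ prim u s b - prim u s a := by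
  rw [h.prim_sub ha hab hb]
  refine Eq.trans_le ?_ (setIntegral_mono_on_ae (integrableOn_const (by simp))
    (h.integrableOn.mono_set (Ioo_subset_Ioo ha hb)) measurableSet_Ioo hC)
  rw [setIntegral_const, Real.volume_real_Ioo_of_le hab, smul_eq_mul, mul_comm]

lemma intg_eq (h : PosIntegrable u s) {a b : ℝ} (ha : 0 ≤ a) (hab : a ≤ b) (hb : b ≤ s) :
    intg u a b = ENNReal.ofReal (prim u s b - prim u s a) := by
  have hsub : Ioo a b ⊆ Ioo 0 s := Ioo_subset_Ioo ha hb
  rw [h.prim_sub ha hab hb, ofReal_integral_eq_lintegral_ofReal (h.integrableOn.mono_set hsub)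
    ((ae_restrict_of_ae_restrict_of_subset hsub h.pos).mono fun x hx => hx.le), intg]

lemma intg_pos (h : PosIntegrable u s) {a b : ℝ} (ha : 0 ≤ a) (hab : a < b) (hb : b ≤ s) :
    0 < intg u a b := by
  have hsub : Ioo a b ⊆ Ioo 0 s := Ioo_subset_Ioo ha hb
  have hm : AEMeasurable (fun x => ENNReal.ofReal (u x)) (volume.restrict (Ioo a b)) :=
    (h.aemeasurable.mono_set hsub).ennreal_ofReal
  rw [intg, pos_iff_ne_zero, Ne, lintegral_eq_zero_iff' hm]
  intro h0
  have h1 : ∀ᵐ x ∂(volume.restrict (Ioo a b)), False := by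
    filter_upwards [h0, ae_restrict_of_ae_restrict_of_subset hsub h.pos] with x h2 h3
    simp only [Pi.zero_apply, ENNReal.ofReal_eq_zero] at h2
    linarith
  have h2 := Filter.eventually_false_iff_eq_bot.1 h1
  rw [ae_eq_bot, Measure.restrict_eq_zero, Real.volume_Ioo, ENNReal.ofReal_eq_zero] at h2
  linarith

lemma intg_ne_top (h : PosIntegrable u s) {a b : ℝ} (ha : 0 ≤ a) (hb : b ≤ s) :
    intg u a b ≠ ∞ :=
  ((lintegral_mono_set (Ioo_subset_Ioo ha hb)).trans_lt h.lt_top).ne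

lemma strictMonoOn_prim (h : PosIntegrable u s) : StrictMonoOn (prim u s) (Icc 0 s) := by
  intro a ha b hb hab
  have := h.intg_pos ha.1 hab hb.2
  rw [h.intg_eq ha.1 hab.le hb.2, ENNReal.ofReal_pos] at this
  linarith

lemma ae_hasDerivAt_prim (h : PosIntegrable u s) :
    ∀ᵐ t, t ∈ Ioo 0 s → HasDerivAt (prim u s) (u t) t := by
  filter_upwards [LocallyIntegrable.ae_hasDerivAt_integral
    h.integrable_indicator.locallyIntegrable] with t ht hts
  have := ht 0
  rwa [indicator_of_mem hts] at this

lemma isPrimitivePair {v : ℝ → ℝ} (hu : PosIntegrable u s) (hv : PosIntegrable v s) :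
    IsPrimitivePair (prim u s) (prim v s) s :=
  ⟨hu.continuous_prim, hv.continuous_prim, hu.strictMonoOn_prim, hv.strictMonoOn_prim⟩

lemma R_eq {v : ℝ → ℝ} (hu : PosIntegrable u s) (hv : PosIntegrable v s) {a b : ℝ} (ha : 0 ≤ a)
    (hab : a < b) (hb : b ≤ s) :
    R u v a b = ENNReal.ofReal ((prim u s b - prim u s a) / (prim v s b - prim v s a)) := by
  have hpos : 0 < prim v s b - prim v s a :=
    sub_pos.2 (hv.strictMonoOn_prim ⟨ha, hab.le.trans hb⟩ ⟨ha.trans hab.le, hb⟩ hab)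
  rw [R, if_neg (EReal.coe_ne_top b), EReal.toReal_coe, hu.intg_eq ha hab.le hb,
    hv.intg_eq ha hab.le hb, ENNReal.ofReal_div_of_pos hpos]

lemma forall_R_le_iff {v : ℝ → ℝ} (hu : PosIntegrable u s) (hv : PosIntegrable v s) {a b : ℝ}
    (ha : 0 ≤ a) (hab : a < b) (hb : b ≤ s) :
    (∀ t : ℝ, a < t → (t : EReal) < b → R u v a t ≤ R u v a b)
      ↔ IsChord (prim u s) (prim v s) a b := by
  have haI : a ∈ Icc 0 s := ⟨ha, hab.le.trans hb⟩
  refine forall_congr' fun t => forall_congr' fun hat => ?_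
  rw [EReal.coe_lt_coe_iff]
  refine forall_congr' fun htb => ?_
  have hbI : b ∈ Icc 0 s := ⟨ha.trans hab.le, hb⟩
  have htI : t ∈ Icc 0 s := ⟨ha.trans hat.le, htb.le.trans hb⟩
  have h1 := sub_pos.2 (hv.strictMonoOn_prim haI htI hat)
  have h2 := sub_pos.2 (hv.strictMonoOn_prim haI hbI hab)
  have h3 := sub_pos.2 (hu.strictMonoOn_prim haI hbI hab)
  rw [hu.R_eq hv ha hat htI.2, hu.R_eq hv ha hab hb,
    ENNReal.ofReal_le_ofReal_iff (div_nonneg h3.le h2.le), div_le_div_iff₀ h1 h2]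

end PosIntegrable

/-! ### Level intervals of functions with bounded support -/

/-- Only `t = α < ∞` goes beyond the definition: on `[t/2, t)` the weight is bounded by `w (t/2)`.
-/
lemma IsWeight.intg_lt_top {α : EReal} {w : ℝ → ℝ} (hw : IsWeight α w) {t : ℝ}
    (ht : (t : EReal) ≤ α) : intg w 0 t < ∞ := by
  rcases le_or_gt t 0 with h0 | h0
  · simp [intg, Ioo_eq_empty (not_lt.2 h0)]
  have hm : t / 2 ∈ I α := ⟨by linarith, (EReal.coe_lt_coe_iff.2 (by linarith)).trans_le ht⟩
  have hsub : Ioo 0 t ⊆ Ioo 0 (t / 2) ∪ Ico (t / 2) t := by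
    intro x hx
    rcases lt_or_ge x (t / 2) with h | h
    · exact Or.inl ⟨hx.1, h⟩
    · exact Or.inr ⟨h, hx.2⟩
  refine (lintegral_mono_set hsub).trans_lt ((lintegral_union_le _ _ _).trans_lt ?_)
  refine ENNReal.add_lt_top.2 ⟨hw.integral_lt_top _ hm, ?_⟩
  have hb : ∫⁻ x in Ico (t / 2) t, ENNReal.ofReal (w x)
      ≤ ∫⁻ x in Ico (t / 2) t, ENNReal.ofReal (w (t / 2)) := by
    refine setLIntegral_mono' measurableSet_Ico fun x hx => ENNReal.ofReal_le_ofReal ?_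
    refine hw.antitoneOn ⟨hm, (half_pos h0).ne'⟩ ⟨⟨hm.1.trans hx.1, ?_⟩, ?_⟩ hx.1
    · exact (EReal.coe_lt_coe_iff.2 hx.2).trans_le ht
    · exact ((half_pos h0).trans_le hx.1).ne'
  refine hb.trans_lt ?_
  rw [setLIntegral_const, Real.volume_Ico]
  exact ENNReal.mul_lt_top ENNReal.ofReal_lt_top ENNReal.ofReal_lt_top

lemma IsWeight.posIntegrable {α : EReal} {w : ℝ → ℝ} (hw : IsWeight α w) {s : ℝ}
    (hs : (s : EReal) ≤ α) : PosIntegrable w s where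
  aemeasurable := AEMeasurable.mono_measure hw.mem_L0 (restrict_Ioo_le hs)
  pos := (ae_restrict_mem measurableSet_Ioo).mono fun x hx =>
    hw.pos x (Ioo_subset_I hs hx) hx.1.ne'
  lt_top := hw.intg_lt_top hs

/-- A function on `I` that is a.e. positive and integrable on `(0, s)` and a.e. zero elsewhere. -/
structure BoundedSupport (α : EReal) (f : ℝ → ℝ) (s : ℝ) : Prop where
  nonneg : 0 ≤ s
  le : (s : EReal) ≤ α
  posIntegrable : PosIntegrable f s
  zero : ∀ᵐ t, t ∈ I α → t ∉ Ioo 0 s → f t = 0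

lemma intg_add {u : ℝ → ℝ} {a b c : ℝ} (hab : a ≤ b) (hbc : b ≤ c) :
    intg u a c = intg u a b + intg u b c := by
  have h1 : (Ioo a c : Set ℝ) =ᵐ[volume] (Ioc a b ∪ Ioc b c : Set ℝ) := by
    rw [Ioc_union_Ioc_eq_Ioc hab hbc]
    exact Ioo_ae_eq_Ioc
  rw [intg, setLIntegral_congr h1, lintegral_union measurableSet_Ioc (Ioc_disjoint_Ioc_of_le le_rfl),
    ← setLIntegral_congr Ioo_ae_eq_Ioc, ← setLIntegral_congr Ioo_ae_eq_Ioc]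
  rfl

namespace BoundedSupport

variable {α : EReal} {f w : ℝ → ℝ} {s : ℝ}

lemma intg_eq_zero (h : BoundedSupport α f s) {a b : ℝ} (ha : s ≤ a) (hb : (b : EReal) ≤ α) :
    intg f a b = 0 := by
  have : ∫⁻ x in Ioo a b, ENNReal.ofReal (f x) = ∫⁻ _ in Ioo a b, 0 := by
    refine setLIntegral_congr_fun_ae measurableSet_Ioo ?_
    filter_upwards [h.zero] with x hx hxab
    rw [hx ⟨h.nonneg.trans (ha.trans hxab.1.le), (EReal.coe_lt_coe_iff.2 hxab.2).trans_le hb⟩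
      fun hh => absurd (ha.trans hxab.1.le) (not_le.2 hh.2), ENNReal.ofReal_zero]
  rw [intg, this, lintegral_zero]

lemma R_coe (f w : ℝ → ℝ) (a b : ℝ) : R f w a b = intg f a b / intg w a b := by
  rw [R, if_neg (EReal.coe_ne_top b), EReal.toReal_coe]

/-- Past `s` the numerator is constant while the denominator still grows. No level interval can
therefore extend beyond `s`. -/
lemma R_lt_of_lt (h : BoundedSupport α f s) (hw : IsWeight α w) {a b : ℝ} (ha : 0 ≤ a)
    (has : a < s) (hsb : s < b) (hb : (b : EReal) ≤ α) : R f w a b < R f w a s := by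
  have hwi := hw.posIntegrable hb
  have hwpos := hwi.intg_pos ha has hsb.le
  have hwpos' := hwi.intg_pos h.nonneg hsb le_rfl
  have hfpos := h.posIntegrable.intg_pos ha has le_rfl
  have hft := h.posIntegrable.intg_ne_top ha le_rfl
  rw [R_coe, R_coe, intg_add has.le hsb.le, h.intg_eq_zero le_rfl hb, add_zero]
  refine (ENNReal.div_lt_div_iff_right hfpos.ne' hft).2 ?_
  rw [intg_add has.le hsb.le]
  exact ENNReal.lt_add_right (hwi.intg_ne_top ha hsb.le) hwpos'.ne'

/-- The level intervals of a function supported in `(0, s)` lie in `(0, s)`. -/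
lemma exists_of_isLevelInterval (h : BoundedSupport α f s) (hw : IsWeight α w) {a : ℝ} {b : EReal}
    (hl : IsLevelInterval α f w a b) :
    0 ≤ a ∧ ∃ b' : ℝ, b = b' ∧ a < b' ∧ b' ≤ s ∧ IsChord (prim f s) (prim w s) a b' := by
  obtain ⟨ha, hab, hbα, hR, hpos⟩ := hl
  refine ⟨ha, ?_⟩
  induction b with
  | bot => exact absurd hab not_lt_bot
  | coe b =>
    rw [EReal.coe_lt_coe_iff] at hab
    have has : a < s := by
      by_contra! hsa
      rw [R_coe, h.intg_eq_zero hsa hbα, ENNReal.zero_div] at hpos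
      exact lt_irrefl _ hpos
    have hbs : b ≤ s := by
      by_contra! hsb
      exact absurd (hR s has (EReal.coe_lt_coe_iff.2 hsb))
        (not_le.2 (h.R_lt_of_lt hw ha has hsb hbα))
    exact ⟨b, rfl, hab, hbs, (h.posIntegrable.forall_R_le_iff
      (hw.posIntegrable h.le) ha hab hbs).1 hR⟩
  | top =>
    exfalso
    have hα : α = ⊤ := top_le_iff.1 hbα
    have hle : ∀ t : ℝ, (t : EReal) ≤ α := fun t => hα ▸ le_top
    have htop : R f w a ⊤ = limsup (fun t : ℝ => intg f a t / intg w a t) atTop := by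
      rw [R, if_pos rfl]
    by_cases has : a < s
    -- For `t ≥ s + 1` the ratio is at most `R(a, s+1) < R(a, s)`, so the limsup stays below `R(a,
    -- s)` and `(a, ∞)` is not a level interval.
    · have h1 := hR s has (EReal.coe_lt_top s)
      have h2 := h.R_lt_of_lt hw ha has (lt_add_one s) (hle _)
      refine absurd (h1.trans ?_) (not_le.2 h2)
      rw [htop]
      refine limsup_le_of_le (h := ?_)
      filter_upwards [eventually_ge_atTop (s + 1)] with t ht
      rw [R_coe, intg_add has.le (le_add_of_nonneg_right zero_le_one),
        h.intg_eq_zero le_rfl (hle _), intg_add has.le (by linarith : s ≤ t),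
        h.intg_eq_zero le_rfl (hle _)]
      exact ENNReal.div_le_div_left (lintegral_mono_set (Ioo_subset_Ioo_right ht)) _
    · rw [htop] at hpos
      have : (fun t : ℝ => intg f a t / intg w a t) = fun _ => 0 := by
        funext t
        rw [h.intg_eq_zero (not_lt.1 has) (hle _), ENNReal.zero_div]
      rw [this, limsup_const] at hpos
      exact lt_irrefl _ hpos

lemma isLevelInterval_of_isChord (h : BoundedSupport α f s) (hw : IsWeight α w) {a b : ℝ}
    (ha : 0 ≤ a) (hab : a < b) (hb : b ≤ s) (hc : IsChord (prim f s) (prim w s) a b) :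
    IsLevelInterval α f w a b := by
  have hwi := hw.posIntegrable h.le
  refine ⟨ha, EReal.coe_lt_coe_iff.2 hab, (EReal.coe_le_coe_iff.2 hb).trans h.le,
    (h.posIntegrable.forall_R_le_iff hwi ha hab hb).2 hc, ?_⟩
  rw [R_coe]
  exact ENNReal.div_pos (h.posIntegrable.intg_pos ha hab hb).ne' (hwi.intg_ne_top ha hb)

lemma isPrimitivePair (h : BoundedSupport α f s) (hw : IsWeight α w) :
    IsPrimitivePair (prim f s) (prim w s) s :=
  h.posIntegrable.isPrimitivePair (hw.posIntegrable h.le)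

lemma not_inMaximal_of_notMem (h : BoundedSupport α f s) (hw : IsWeight α w) {t : ℝ}
    (ht : t ∉ Ioo 0 s) (p : ℝ × EReal) : ¬ InMaximal α f w t p := by
  rintro ⟨hp, h1, h2⟩
  obtain ⟨ha, b, hb, -, hbs, -⟩ := h.exists_of_isLevelInterval hw hp.1
  rw [hb, EReal.coe_lt_coe_iff] at h2
  exact ht ⟨ha.trans_lt h1, h2.trans_le hbs⟩

/-- The maximal level interval around `t` is the interval between the extreme maximizers. -/
lemma inMaximal_iff (h : BoundedSupport α f s) (hw : IsWeight α w) {t l : ℝ}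
    (hlo : lo (prim f s) (prim w s) s l ≤ t) (hhi : t ≤ hi (prim f s) (prim w s) s l)
    (ht : t ∈ Ioo 0 s) (p : ℝ × EReal) :
    InMaximal α f w t p ↔ lo (prim f s) (prim w s) s l < t ∧ t < hi (prim f s) (prim w s) s l ∧
      p = (lo (prim f s) (prim w s) s l, ((hi (prim f s) (prim w s) s l : ℝ) : EReal)) := by
  have hP := h.isPrimitivePair hw
  have hs := ht.1.trans ht.2
  have hmlo := (hP.lo_mem hs l).1
  have hmhi := (hP.hi_mem hs l).1
  have hch := hP.isChord_lo_hi hs l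
  -- Every level interval around `t` sits inside `[lo, hi]`, and `(lo, hi)` is itself a level
  -- interval when nonempty.
  have key : ∀ {a : ℝ} {b : EReal}, IsLevelInterval α f w a b → a < t → (t : EReal) < b →
      lo (prim f s) (prim w s) s l ≤ a ∧ b ≤ ((hi (prim f s) (prim w s) s l : ℝ) : EReal) := by
    intro a b hl h1 h2
    obtain ⟨ha, b, rfl, -, hbs, hc⟩ := h.exists_of_isLevelInterval hw hl
    rw [EReal.coe_lt_coe_iff] at h2
    rw [EReal.coe_le_coe_iff]
    exact hP.lo_le_and_le_hi_of_isChord ha hbs hc h1 h2 hlo hhi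
  constructor
  · rintro ⟨hp, h1, h2⟩
    obtain ⟨h3, h4⟩ := key hp.1 h1 h2
    have h5 := h3.trans_lt h1
    have h6 := EReal.coe_lt_coe_iff.1 (h2.trans_le h4)
    obtain ⟨h7, h8⟩ := hp.2 _ _
      (h.isLevelInterval_of_isChord hw hmlo.1 (h5.trans h6) hmhi.2 hch) h3 h4
    exact ⟨h5, h6, Prod.ext h7.symm h8.symm⟩
  · rintro ⟨h1, h2, rfl⟩
    refine ⟨⟨h.isLevelInterval_of_isChord hw hmlo.1 (h1.trans h2) hmhi.2 hch, ?_⟩, h1,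
      EReal.coe_lt_coe_iff.2 h2⟩
    intro a' b' hl ha hb
    obtain ⟨h3, h4⟩ := key hl (lt_of_le_of_lt ha h1)
      ((EReal.coe_lt_coe_iff.2 h2).trans_le hb)
    exact ⟨le_antisymm ha h3, le_antisymm h4 hb⟩

lemma R_lo_hi (h : BoundedSupport α f s) (hw : IsWeight α w) (hs : 0 < s) {l : ℝ}
    (hl : lo (prim f s) (prim w s) s l < hi (prim f s) (prim w s) s l) :
    R f w (lo (prim f s) (prim w s) s l) ((hi (prim f s) (prim w s) s l : ℝ) : EReal)
      = ENNReal.ofReal l := by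
  have hP := h.isPrimitivePair hw
  have hmlo := (hP.lo_mem hs l).1
  have hmhi := (hP.hi_mem hs l).1
  rw [h.posIntegrable.R_eq (hw.posIntegrable h.le) hmlo.1 hl hmhi.2, hP.sub_lo_hi hs,
    mul_div_cancel_right₀]
  exact (sub_pos.2 (hP.strictMonoOn_right hmlo hmhi hl)).ne'

/-- The slope `f⁰ / w` of the level function on `(0, s)`. -/
abbrev levelSlope (f w : ℝ → ℝ) (s t : ℝ) : ℝ := majSlope (prim f s) (prim w s) s t

/-- Almost everywhere, `t` lies strictly between the extreme maximizers, or `f = f⁰` at `t`. -/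
lemma ae_eq_levelSlope_mul (h : BoundedSupport α f s) (hw : IsWeight α w) :
    ∀ᵐ t, t ∈ Ioo 0 s →
      (lo (prim f s) (prim w s) s (levelSlope f w s t) < t ∧
        t < hi (prim f s) (prim w s) s (levelSlope f w s t)) ∨
      (¬ (lo (prim f s) (prim w s) s (levelSlope f w s t) < t ∧
        t < hi (prim f s) (prim w s) s (levelSlope f w s t)) ∧
        f t = levelSlope f w s t * w t) := by
  have hP := h.isPrimitivePair hw
  filter_upwards [h.posIntegrable.ae_hasDerivAt_prim,
    (hw.posIntegrable h.le).ae_hasDerivAt_prim] with t hf' hw' ht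
  have hs := ht.1.trans ht.2
  obtain ⟨-, h1, h2⟩ := hP.majSlope_spec ht
  refine or_iff_not_imp_left.2 fun hn => ⟨hn, ?_⟩
  -- Here `t` equals `lo` or `hi`, hence is a maximizer, and the first-order condition reads `f t =
  -- l w t`.
  refine IsPrimitivePair.hasDerivAt_eq_of_mem_maximizers ht ?_ (hf' ht) (hw' ht)
  rcases h1.eq_or_lt with h1 | h1
  · have := hP.lo_mem hs (levelSlope f w s t)
    rwa [h1] at this
  · have h3 : t = hi (prim f s) (prim w s) s (levelSlope f w s t) :=
      le_antisymm h2 (not_lt.1 fun h3 => hn ⟨h1, h3⟩)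
    have := hP.hi_mem hs (levelSlope f w s t)
    rwa [← h3] at this

lemma levelFun_ae_eq (h : BoundedSupport α f s) (hw : IsWeight α w) :
    ∀ᵐ t, t ∈ Ioo 0 s → levelFun α f w t = ENNReal.ofReal (levelSlope f w s t * w t) ∧
      invLevelFun α f w t = ENNReal.ofReal (f t / levelSlope f w s t) := by
  have hP := h.isPrimitivePair hw
  filter_upwards [h.ae_eq_levelSlope_mul hw] with t hor ht
  obtain ⟨hpos, h1, h2⟩ := hP.majSlope_spec ht
  have hiff := h.inMaximal_iff hw h1 h2 ht
  rcases hor ht with ⟨h3, h4⟩ | ⟨hn, heq⟩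
  · have hex : ∃ p, InMaximal α f w t p := ⟨_, (hiff _).2 ⟨h3, h4, rfl⟩⟩
    have hch := ((hiff _).1 hex.choose_spec).2.2
    have hR : R f w hex.choose.1 hex.choose.2 = ENNReal.ofReal (levelSlope f w s t) := by
      rw [hch]
      exact h.R_lo_hi hw (ht.1.trans ht.2) (h3.trans h4)
    rw [levelFun, dif_pos hex, invLevelFun, dif_pos hex, hR, ENNReal.ofReal_mul hpos.le,
      ENNReal.ofReal_div_of_pos hpos]
    exact ⟨rfl, rfl⟩
  · have hex : ¬ ∃ p, InMaximal α f w t p := by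
      rintro ⟨p, hp⟩
      obtain ⟨h3, h4, -⟩ := (hiff p).1 hp
      exact hn ⟨h3, h4⟩
    rw [levelFun, dif_neg hex, invLevelFun, dif_neg hex, heq, mul_div_cancel_left₀ _ hpos.ne']
    exact ⟨rfl, rfl⟩

lemma levelFun_of_notMem (h : BoundedSupport α f s) (hw : IsWeight α w) {t : ℝ}
    (ht : t ∉ Ioo 0 s) :
    levelFun α f w t = ENNReal.ofReal (f t) ∧ invLevelFun α f w t = ENNReal.ofReal (w t) := by
  have hex : ¬ ∃ p, InMaximal α f w t p := fun ⟨p, hp⟩ => h.not_inMaximal_of_notMem hw ht p hp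
  rw [levelFun, dif_neg hex, invLevelFun, dif_neg hex]
  exact ⟨rfl, rfl⟩

/-! ### Functions of the slope have the same integral against `f` and `f⁰` -/

/-- `k` needs no measurability: the slope is constant on each level interval, and off their union
the two integrands agree a.e. -/
lemma lintegral_levelSlope_mul (h : BoundedSupport α f s) (hw : IsWeight α w) (k : ℝ → ℝ≥0∞) :
    ∫⁻ t in Ioo 0 s, k (levelSlope f w s t) * ENNReal.ofReal (f t)
      = ∫⁻ t in Ioo 0 s, k (levelSlope f w s t) * ENNReal.ofReal (levelSlope f w s t * w t) := by
  rcases h.nonneg.eq_or_lt with rfl | hs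
  · simp
  have hP := h.isPrimitivePair hw
  have hwi := hw.posIntegrable h.le
  set U : ℝ → Set ℝ := fun l => Ioo (lo (prim f s) (prim w s) s l) (hi (prim f s) (prim w s) s l)
    with hU
  set Λ : Set ℝ := {l | (U l).Nonempty} with hΛ
  have hUs : ∀ l, U l ⊆ Ioo 0 s := fun l =>
    Ioo_subset_Ioo (hP.lo_mem hs l).1.1 (hP.hi_mem hs l).1.2
  have hdisj : ∀ {l l'}, l < l' → Disjoint (U l) (U l') := by
    intro l l' hl
    refine Set.disjoint_left.2 fun x hx hx' => ?_
    exact absurd (hP.hi_le_lo_of_lt hs hl) (not_le.2 (hx.1.trans hx'.2))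
  have hdisj' : Λ.PairwiseDisjoint U := by
    intro l _ l' _ hne
    rcases lt_or_gt_of_ne hne with hl | hl
    · exact hdisj hl
    · exact (hdisj hl).symm
  -- Disjoint nonempty open sets of reals are countably many, so the integral over their union is a
  -- sum.
  have hcount : Λ.Countable :=
    hdisj'.countable_of_isOpen (fun l _ => isOpen_Ioo) fun l hl => hl
  have hval : ∀ {l t}, t ∈ U l → levelSlope f w s t = l := fun ht =>
    hP.majSlope_eq (hUs _ ht) ht.1 ht.2
  set V : Set ℝ := ⋃ l ∈ Λ, U l with hV
  have hVm : MeasurableSet V := MeasurableSet.biUnion hcount fun l _ => measurableSet_Ioo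
  have hVs : V ⊆ Ioo 0 s := iUnion₂_subset fun l _ => hUs l
  have hon : ∫⁻ t in V, k (levelSlope f w s t) * ENNReal.ofReal (f t)
      = ∫⁻ t in V, k (levelSlope f w s t) * ENNReal.ofReal (levelSlope f w s t * w t) := by
    rw [hV, lintegral_biUnion hcount (fun l _ => measurableSet_Ioo) hdisj',
      lintegral_biUnion hcount (fun l _ => measurableSet_Ioo) hdisj']
    refine tsum_congr fun ⟨l, hl⟩ => ?_
    have hlt : lo (prim f s) (prim w s) s l < hi (prim f s) (prim w s) s l := nonempty_Ioo.1 hl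
    have hmlo := (hP.lo_mem hs l).1
    have hmhi := (hP.hi_mem hs l).1
    have hl0 : 0 < l := by
      obtain ⟨x, hx⟩ := hl
      rw [← hval hx]
      exact (hP.majSlope_spec (hUs _ hx)).1
    have e1 : ∫⁻ t in U l, k (levelSlope f w s t) * ENNReal.ofReal (f t)
        = ∫⁻ t in U l, k l * ENNReal.ofReal (f t) :=
      setLIntegral_congr_fun measurableSet_Ioo fun t ht => by
        rw [hval ht]
    have e2 : ∫⁻ t in U l, k (levelSlope f w s t) * ENNReal.ofReal (levelSlope f w s t * w t)
        = ∫⁻ t in U l, k l * (ENNReal.ofReal l * ENNReal.ofReal (w t)) :=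
      setLIntegral_congr_fun measurableSet_Ioo fun t ht => by
        rw [hval ht, ENNReal.ofReal_mul hl0.le]
    have hfm : AEMeasurable (fun t => ENNReal.ofReal (f t)) (volume.restrict (U l)) :=
      (h.posIntegrable.aemeasurable.mono_set (hUs l)).ennreal_ofReal
    have hwm : AEMeasurable (fun t => ENNReal.ofReal (w t)) (volume.restrict (U l)) :=
      (hwi.aemeasurable.mono_set (hUs l)).ennreal_ofReal
    rw [e1, e2, lintegral_const_mul'' _ hfm, lintegral_const_mul'' _ (hwm.const_mul _),
      lintegral_const_mul'' _ hwm]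
    congr 1
    change intg f _ _ = _ * intg w _ _
    rw [h.posIntegrable.intg_eq hmlo.1 hlt.le hmhi.2, hwi.intg_eq hmlo.1 hlt.le hmhi.2,
      ← ENNReal.ofReal_mul hl0.le, hP.sub_lo_hi hs]
  have hoff : ∫⁻ t in Ioo 0 s \ V, k (levelSlope f w s t) * ENNReal.ofReal (f t)
      = ∫⁻ t in Ioo 0 s \ V,
        k (levelSlope f w s t) * ENNReal.ofReal (levelSlope f w s t * w t) := by
    refine setLIntegral_congr_fun_ae (measurableSet_Ioo.diff hVm) ?_
    filter_upwards [h.ae_eq_levelSlope_mul hw] with t hor ht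
    rcases hor ht.1 with hin | ⟨-, heq⟩
    · exact absurd (mem_iUnion₂.2 ⟨levelSlope f w s t, ⟨t, hin⟩, hin⟩) ht.2
    · rw [← heq]
  have hsplit : ∀ g : ℝ → ℝ≥0∞,
      ∫⁻ t in Ioo 0 s, g t = (∫⁻ t in V, g t) + ∫⁻ t in Ioo 0 s \ V, g t := by
    intro g
    rw [← lintegral_inter_add_sdiff g (Ioo 0 s) hVm, inter_eq_self_of_subset_right hVs]
  rw [hsplit, hsplit, hon, hoff]

end BoundedSupport

/-! ### Submajorization by a weight -/

lemma ae_mem_I_diff_zero {α : EReal} : ∀ᵐ x ∂(μ α), x ∈ I α \ {0} := by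
  filter_upwards [ae_restrict_mem (measurableSet_I α),
    ae_restrict_of_ae (Measure.ae_ne volume (0 : ℝ))] with x h1 h2 using ⟨h1, h2⟩

lemma IsWeight.lintegral_rearr_le {α : EReal} {w : ℝ → ℝ} (hw : IsWeight α w) {t : ℝ}
    (ht : (t : EReal) ≤ α) : ∫⁻ x in Ioo 0 t, rearr α w x ≤ intg w 0 t :=
  lintegral_rearr_le_of_antitoneOn hw.mem_L0 ae_mem_I_diff_zero hw.antitoneOn
    (fun x hx => (hw.pos x hx.1 hx.2).le) ht

/-- The chain is `∫ |g| ≤ ∫ g* ≤ ∫ w* ≤ ∫ w`. The lower bound uses `g ≺ w` only in this form, free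
of rearrangements. -/
lemma Submaj.lintegral_abs_le {α : EReal} {g w : ℝ → ℝ} (hw : IsWeight α w) (hg : g ∈ L0 α)
    (h : Submaj α g w) {t : ℝ} (ht : t ∈ I α) :
    ∫⁻ x in Ioo 0 t, ENNReal.ofReal |g x| ≤ intg w 0 t :=
  (lintegral_abs_le_lintegral_rearr hg ht.2.le).trans
    ((h t ht).trans (hw.lintegral_rearr_le ht.2.le))

/-- Functions in the modular space are integrable on bounded intervals. -/
lemma intg_lt_top_of_mem_M {α : EReal} {φ w f : ℝ → ℝ} (hφ : IsOrlicz φ) (hw : IsWeight α w)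
    (hf : f ∈ M α φ w) {s : ℝ} (hs : (s : EReal) ≤ α) : intg f 0 s < ∞ := by
  obtain ⟨hf0, c, hc, hP⟩ := hf
  simp only [P, iInf_lt_iff] at hP
  obtain ⟨g, ⟨hg, hgw⟩, hfin⟩ := hP
  have hgm : AEMeasurable (fun x => ENNReal.ofReal |g x|) (volume.restrict (Ioo 0 s)) :=
    (continuous_abs.measurable.comp_aemeasurable
      (AEMeasurable.mono_measure hg (restrict_Ioo_le hs))).ennreal_ofReal
  have hgs : ∫⁻ x in Ioo 0 s, ENNReal.ofReal |g x| ≤ intg w 0 s :=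
    setLIntegral_Ioo_le_of_forall_lt fun t ht =>
      hgw.lintegral_abs_le hw hg (Ioo_subset_I hs ht)
  have hd := hφ.rderiv_pos one_pos
  -- The tangent inequality at the arbitrary point `1` bounds the rearrangement by two integrable
  -- terms.
  have h1 : ENNReal.ofReal (rderiv φ 1) * ∫⁻ x in Ioo 0 s, rearr α (fun t => f t / c) x < ∞ := by
    rw [← lintegral_const_mul _ (rearr_antitone α _).measurable]
    refine (lintegral_mono fun x => hφ.rderiv_mul_le_persp_add one_pos
      (rearr α (fun t => f t / c) x) (v := ENNReal.ofReal |g x|) ENNReal.ofReal_ne_top).trans_lt ?_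
    rw [lintegral_add_right' _ (hgm.const_mul _), lintegral_const_mul'' _ hgm]
    refine ENNReal.add_lt_top.2 ⟨(lintegral_mono' (restrict_Ioo_le hs) le_rfl).trans_lt hfin, ?_⟩
    exact ENNReal.mul_lt_top ENNReal.ofReal_lt_top (hgs.trans_lt (hw.intg_lt_top hs))
  have h2 : ∫⁻ x in Ioo 0 s, rearr α (fun t => f t / c) x < ∞ :=
    ENNReal.lt_top_of_mul_ne_top_right h1.ne (by simpa using hd)
  have h3 : ∫⁻ x in Ioo 0 s, ENNReal.ofReal |f x / c| < ∞ :=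
    (lintegral_abs_le_lintegral_rearr (AEMeasurable.div_const hf0 c) hs).trans_lt h2
  calc intg f 0 s ≤ ∫⁻ x in Ioo 0 s, ENNReal.ofReal c * ENNReal.ofReal |f x / c| := by
        refine lintegral_mono fun x => ?_
        rw [← ENNReal.ofReal_mul hc.le]
        refine ENNReal.ofReal_le_ofReal ?_
        calc f x = c * (f x / c) := (mul_div_cancel₀ _ hc.ne').symm
          _ ≤ _ := mul_le_mul_of_nonneg_left (le_abs_self _) hc.le
    _ < ∞ := by
        rw [lintegral_const_mul' _ _ ENNReal.ofReal_ne_top]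
        exact ENNReal.mul_lt_top ENNReal.ofReal_lt_top h3

namespace BoundedSupport

variable {α : EReal} {φ f w : ℝ → ℝ} {s : ℝ}

lemma levelSlope_pos (h : BoundedSupport α f s) (hw : IsWeight α w) {t : ℝ} (ht : t ∈ Ioo 0 s) :
    0 < levelSlope f w s t :=
  ((h.isPrimitivePair hw).majSlope_spec ht).1

/-! ### The lower bound -/

lemma lintegral_truncated_le (h : BoundedSupport α f s) (hφ : IsOrlicz φ) (hw : IsWeight α w)
    {g : ℝ → ℝ} (hg : g ∈ L0 α)
    (hgw : ∀ t ∈ Ioo 0 s, ∫⁻ x in Ioo 0 t, ENNReal.ofReal |g x| ≤ intg w 0 t)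
    {N : ℝ} (hN : 0 < N) :
    ∫⁻ t in Ioo 0 s, ENNReal.ofReal (φ (min (levelSlope f w s t) N)) * ENNReal.ofReal (w t)
      ≤ ∫⁻ t in Ioo 0 s, persp φ (ENNReal.ofReal (f t)) (ENNReal.ofReal |g t|) := by
  have hwi := hw.posIntegrable h.le
  have hwm : AEMeasurable (fun x => ENNReal.ofReal (w x)) (volume.restrict (Ioo 0 s)) :=
    hwi.aemeasurable.ennreal_ofReal
  have hgm : AEMeasurable (fun x => ENNReal.ofReal |g x|) (volume.restrict (Ioo 0 s)) :=
    (continuous_abs.measurable.comp_aemeasurable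
      (AEMeasurable.mono_measure hg (restrict_Ioo_le h.le))).ennreal_ofReal
  set c : ℝ → ℝ := fun t => min (levelSlope f w s t) N with hc
  have hcpos : ∀ t ∈ Ioo 0 s, 0 < c t := fun t ht => lt_min (h.levelSlope_pos hw ht) hN
  have hcanti : AntitoneOn c (Ioo 0 s) := fun x hx y hy hxy =>
    min_le_min_right _ ((h.isPrimitivePair hw).majSlope_antitoneOn hx hy hxy)
  have hkanti : AntitoneOn (fun t => ENNReal.ofReal (conj φ (c t))) (Ioo 0 s) :=
    fun x hx y hy hxy => ENNReal.ofReal_le_ofReal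
      (hφ.conj_monotoneOn (hcpos y hy) (hcpos x hx) (hcanti hx hy hxy))
  have hkm : AEMeasurable (fun t => ENNReal.ofReal (conj φ (c t))) (volume.restrict (Ioo 0 s)) :=
    aemeasurable_restrict_of_antitoneOn measurableSet_Ioo hkanti
  set A := ∫⁻ t in Ioo 0 s, ENNReal.ofReal (φ (c t)) * ENNReal.ofReal (w t) with hA
  set B := ∫⁻ t in Ioo 0 s, ENNReal.ofReal (conj φ (c t)) * ENNReal.ofReal (w t) with hB
  -- Finiteness of `B`, needed for the final cancellation, is the reason for truncating the slope at
  -- `N`.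
  have hBtop : B ≠ ∞ := by
    refine ne_of_lt (lt_of_le_of_lt (b := ∫⁻ t in Ioo 0 s,
      ENNReal.ofReal (conj φ N) * ENNReal.ofReal (w t)) ?_ ?_)
    · refine setLIntegral_mono' measurableSet_Ioo fun t ht => mul_le_mul_left ?_ _
      exact ENNReal.ofReal_le_ofReal (hφ.conj_monotoneOn (hcpos t ht) hN (min_le_right _ _))
    · rw [lintegral_const_mul'' _ hwm]
      exact ENNReal.mul_lt_top ENNReal.ofReal_lt_top hwi.lt_top
  -- The truncated derivative is a function of the slope, so `f` may be traded for `h w`; then `φ(c)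
  -- + conj φ c = φ'(c) c ≤ φ'(c) h`.
  have h1 : A + B ≤ ∫⁻ t in Ioo 0 s, ENNReal.ofReal (rderiv φ (c t)) * ENNReal.ofReal (f t) := by
    rw [h.lintegral_levelSlope_mul hw (fun l => ENNReal.ofReal (rderiv φ (min l N))), hA, hB,
      ← lintegral_add_right' _ (hkm.fun_mul hwm)]
    refine setLIntegral_mono' measurableSet_Ioo fun t ht => ?_
    have hct := hcpos t ht
    have hwt : 0 < w t := hw.pos t (Ioo_subset_I h.le ht) ht.1.ne'
    rw [← add_mul, ← ENNReal.ofReal_add (hφ.nonneg hct.le) (hφ.conj_nonneg hct),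
      ← ENNReal.ofReal_mul (add_nonneg (hφ.nonneg hct.le) (hφ.conj_nonneg hct)),
      ← ENNReal.ofReal_mul (hφ.rderiv_pos hct).le]
    refine ENNReal.ofReal_le_ofReal ?_
    have h2 : φ (c t) + conj φ (c t) = rderiv φ (c t) * c t := by
      unfold conj
      ring
    rw [h2, mul_assoc]
    exact mul_le_mul_of_nonneg_left (mul_le_mul_of_nonneg_right (min_le_left _ _) hwt.le)
      (hφ.rderiv_pos hct).le
  have h2 : ∫⁻ t in Ioo 0 s, ENNReal.ofReal (rderiv φ (c t)) * ENNReal.ofReal (f t)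
      ≤ (∫⁻ t in Ioo 0 s, persp φ (ENNReal.ofReal (f t)) (ENNReal.ofReal |g t|))
        + ∫⁻ t in Ioo 0 s, ENNReal.ofReal (conj φ (c t)) * ENNReal.ofReal |g t| := by
    rw [← lintegral_add_right' _ (hkm.fun_mul hgm)]
    exact setLIntegral_mono' measurableSet_Ioo fun t ht =>
      hφ.rderiv_mul_le_persp_add (hcpos t ht) _ ENNReal.ofReal_ne_top
  have h3 : ∫⁻ t in Ioo 0 s, ENNReal.ofReal (conj φ (c t)) * ENNReal.ofReal |g t| ≤ B :=
    lintegral_mul_le_of_antitoneOn hgm hwm hkanti hgw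
  exact (ENNReal.add_le_add_iff_right hBtop).1 (h1.trans (h2.trans (add_le_add_right h3 _)))

/-- Monotone convergence removes the truncation; the levels `n + 1` are positive from the start. -/
lemma lintegral_le_lintegral_persp (h : BoundedSupport α f s) (hφ : IsOrlicz φ)
    (hw : IsWeight α w) {g : ℝ → ℝ} (hg : g ∈ L0 α)
    (hgw : ∀ t ∈ Ioo 0 s, ∫⁻ x in Ioo 0 t, ENNReal.ofReal |g x| ≤ intg w 0 t) :
    ∫⁻ t in Ioo 0 s, ENNReal.ofReal (φ (levelSlope f w s t)) * ENNReal.ofReal (w t)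
      ≤ ∫⁻ t in Ioo 0 s, persp φ (ENNReal.ofReal (f t)) (ENNReal.ofReal |g t|) := by
  have hwi := hw.posIntegrable h.le
  have hpos : ∀ (n : ℕ), (0 : ℝ) < n + 1 := fun n => by positivity
  have hmono : MonotoneOn φ (Ici 0) := hφ.strictMonoOn.monotoneOn
  have hcpos : ∀ (n : ℕ), ∀ t ∈ Ioo 0 s, (0 : ℝ) ≤ min (levelSlope f w s t) (n + 1) :=
    fun n t ht => le_min (h.levelSlope_pos hw ht).le (hpos n).le
  refine le_of_tendsto' (lintegral_tendsto_of_tendsto_of_monotone (μ := volume.restrict (Ioo 0 s))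
    (f := fun (n : ℕ) t => ENNReal.ofReal (φ (min (levelSlope f w s t) (n + 1)))
      * ENNReal.ofReal (w t)) ?_ ?_ ?_) fun n => h.lintegral_truncated_le hφ hw hg hgw (hpos n)
  · intro n
    refine AEMeasurable.mul ?_ hwi.aemeasurable.ennreal_ofReal
    refine aemeasurable_restrict_of_antitoneOn measurableSet_Ioo fun x hx y hy hxy => ?_
    exact ENNReal.ofReal_le_ofReal (hmono (hcpos n y hy) (hcpos n x hx)
      (min_le_min_right _ ((h.isPrimitivePair hw).majSlope_antitoneOn hx hy hxy)))
  · filter_upwards [ae_restrict_mem measurableSet_Ioo] with t ht m n hmn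
    refine mul_le_mul_left (ENNReal.ofReal_le_ofReal (hmono (hcpos m t ht) (hcpos n t ht) ?_)) _
    exact min_le_min_left _ (by simpa using hmn)
  · filter_upwards with t
    obtain ⟨n₀, hn₀⟩ := exists_nat_ge (levelSlope f w s t)
    refine tendsto_const_nhds.congr' ?_
    filter_upwards [eventually_ge_atTop n₀] with n hn
    have : (n₀ : ℝ) ≤ n := by exact_mod_cast hn
    rw [min_eq_left (by linarith)]

/-! ### The inverse level function is decreasing and submajorized by the weight -/

/-- A version of the inverse level function: `f / h` on `(0, s)`, where `h` is the slope of the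
level function, and `w` elsewhere. -/
def invSlopeFun (f w : ℝ → ℝ) (s : ℝ) : ℝ → ℝ :=
  (Ioo 0 s).piecewise (fun t => f t / levelSlope f w s t) w

lemma invSlopeFun_of_mem {t : ℝ} (ht : t ∈ Ioo 0 s) :
    invSlopeFun f w s t = f t / levelSlope f w s t :=
  piecewise_eq_of_mem _ _ _ ht

lemma invSlopeFun_of_notMem {t : ℝ} (ht : t ∉ Ioo 0 s) : invSlopeFun f w s t = w t :=
  piecewise_eq_of_notMem _ _ _ ht

lemma aemeasurable_levelSlope (h : BoundedSupport α f s) (hw : IsWeight α w) :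
    AEMeasurable (levelSlope f w s) (volume.restrict (Ioo 0 s)) :=
  aemeasurable_restrict_of_antitoneOn measurableSet_Ioo (h.isPrimitivePair hw).majSlope_antitoneOn

lemma invSlopeFun_mem_L0 (h : BoundedSupport α f s) (hw : IsWeight α w) :
    invSlopeFun f w s ∈ L0 α := by
  have h1 := (aemeasurable_indicator_iff measurableSet_Ioo).2
    (h.posIntegrable.aemeasurable.div (h.aemeasurable_levelSlope hw))
  have h2 : AEMeasurable ((Ioo 0 s)ᶜ.indicator w) (μ α) :=
    AEMeasurable.indicator hw.mem_L0 measurableSet_Ioo.compl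
  refine ((h1.mono_measure Measure.restrict_le_self).add h2).congr (ae_of_all _ fun t => ?_)
  by_cases ht : t ∈ Ioo 0 s
  · rw [invSlopeFun_of_mem ht, Pi.add_apply, indicator_of_mem ht,
      indicator_of_notMem (notMem_compl_iff.2 ht), add_zero, Pi.div_apply]
  · rw [invSlopeFun_of_notMem ht, Pi.add_apply, indicator_of_notMem ht,
      indicator_of_mem (mem_compl ht), zero_add]

/-- Put `l = levelSlope f w s t`. Over `(t, hi l)` one has `l ΔW ≤ ΔF`, as `hi l` is a maximizer,
while monotonicity gives `ΔF ≤ f t Δt` and `w x Δt ≤ ΔW`. If the interval is empty, `f t = l w t`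
and `w` decreases. -/
lemma w_le_div_levelSlope (h : BoundedSupport α f s) (hw : IsWeight α w) {D : Set ℝ}
    (hD : ∀ᵐ t, t ∈ Ioo 0 s → t ∈ D) (hf : AntitoneOn f D) {t x : ℝ} (ht : t ∈ Ioo 0 s)
    (htD : t ∈ D)
    (hor : t < hi (prim f s) (prim w s) s (levelSlope f w s t) ∨ f t = levelSlope f w s t * w t)
    (hx : x ∈ I α) (hxhi : hi (prim f s) (prim w s) s (levelSlope f w s t) ≤ x) :
    w x ≤ f t / levelSlope f w s t := by
  have hP := h.isPrimitivePair hw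
  obtain ⟨hl, -, h2⟩ := hP.majSlope_spec ht
  rw [le_div_iff₀ hl]
  have hx' : x ∈ I α \ {0} := ⟨hx, (ht.1.trans_le (h2.trans hxhi)).ne'⟩
  have htI : t ∈ I α \ {0} := ⟨Ioo_subset_I h.le ht, ht.1.ne'⟩
  rcases hor with hlt | heq
  · have hhi := (hP.hi_mem (ht.1.trans ht.2) (levelSlope f w s t)).1
    have h3 := hP.le_hi_sub (ht.1.trans ht.2) (levelSlope f w s t) ⟨ht.1.le, ht.2.le⟩
    have h4 : prim f s (hi (prim f s) (prim w s) s (levelSlope f w s t)) - prim f s t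
        ≤ f t * (hi (prim f s) (prim w s) s (levelSlope f w s t) - t) := by
      refine h.posIntegrable.prim_sub_le ht.1.le hlt.le hhi.2 ?_
      filter_upwards [hD] with y hy hyt
      exact hf htD (hy ⟨ht.1.trans hyt.1, hyt.2.trans_le hhi.2⟩) hyt.1.le
    have h5 : w x * (hi (prim f s) (prim w s) s (levelSlope f w s t) - t)
        ≤ prim w s (hi (prim f s) (prim w s) s (levelSlope f w s t)) - prim w s t := by
      refine (hw.posIntegrable h.le).le_prim_sub ht.1.le hlt.le hhi.2 (ae_of_all _ fun y hy => ?_)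
      have hy0 := ht.1.trans hy.1
      exact hw.antitoneOn ⟨Ioo_subset_I h.le ⟨hy0, hy.2.trans_le hhi.2⟩, hy0.ne'⟩ hx'
        (hy.2.le.trans hxhi)
    have h6 := mul_le_mul_of_nonneg_left h5 hl.le
    refine le_of_mul_le_mul_right ?_ (sub_pos.2 hlt)
    linarith
  · rw [heq, mul_comm]
    exact mul_le_mul_of_nonneg_left (hw.antitoneOn htI hx' (h2.trans hxhi)) hl.le

/-- The mirror image over `(lo l, t)`. Together the two bounds let a value of `w` separate the
values of `f / h` at points of different slope. -/
lemma div_levelSlope_le_w (h : BoundedSupport α f s) (hw : IsWeight α w) {D : Set ℝ}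
    (hD : ∀ᵐ t, t ∈ Ioo 0 s → t ∈ D) (hf : AntitoneOn f D) {t x : ℝ} (ht : t ∈ Ioo 0 s)
    (htD : t ∈ D)
    (hor : lo (prim f s) (prim w s) s (levelSlope f w s t) < t ∨ f t = levelSlope f w s t * w t)
    (hx : 0 < x) (hxlo : x ≤ lo (prim f s) (prim w s) s (levelSlope f w s t)) :
    f t / levelSlope f w s t ≤ w x := by
  have hP := h.isPrimitivePair hw
  obtain ⟨hl, h1, -⟩ := hP.majSlope_spec ht
  rw [div_le_iff₀ hl]
  have htI : t ∈ I α \ {0} := ⟨Ioo_subset_I h.le ht, ht.1.ne'⟩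
  have hx' : x ∈ I α \ {0} :=
    ⟨Ioo_subset_I h.le ⟨hx, (hxlo.trans h1).trans_lt ht.2⟩, hx.ne'⟩
  rcases hor with hlt | heq
  · have hlo := (hP.lo_mem (ht.1.trans ht.2) (levelSlope f w s t)).1
    have h3 := hP.sub_lo_le (ht.1.trans ht.2) (levelSlope f w s t) ⟨ht.1.le, ht.2.le⟩
    have h4 : f t * (t - lo (prim f s) (prim w s) s (levelSlope f w s t))
        ≤ prim f s t - prim f s (lo (prim f s) (prim w s) s (levelSlope f w s t)) := by
      refine h.posIntegrable.le_prim_sub hlo.1 hlt.le ht.2.le ?_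
      filter_upwards [hD] with y hy hyt
      exact hf (hy ⟨hlo.1.trans_lt hyt.1, hyt.2.trans ht.2⟩) htD hyt.2.le
    have h5 : prim w s t - prim w s (lo (prim f s) (prim w s) s (levelSlope f w s t))
        ≤ w x * (t - lo (prim f s) (prim w s) s (levelSlope f w s t)) := by
      refine (hw.posIntegrable h.le).prim_sub_le hlo.1 hlt.le ht.2.le (ae_of_all _ fun y hy => ?_)
      have hy0 := hlo.1.trans_lt hy.1
      exact hw.antitoneOn hx' ⟨Ioo_subset_I h.le ⟨hy0, hy.2.trans ht.2⟩, hy0.ne'⟩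
        (hxlo.trans hy.1.le)
    have h6 := mul_le_mul_of_nonneg_left h5 hl.le
    refine le_of_mul_le_mul_right ?_ (sub_pos.2 hlt)
    linarith
  · rw [heq, mul_comm]
    exact mul_le_mul_of_nonneg_right (hw.antitoneOn hx' htI (hxlo.trans h1)) hl.le

/-- The inverse level function decreases on a set of full measure. -/
lemma exists_antitoneOn_invSlopeFun (h : BoundedSupport α f s) (hw : IsWeight α w) {D : Set ℝ}
    (hD : ∀ᵐ t, t ∈ Ioo 0 s → t ∈ D) (hf : AntitoneOn f D) :
    ∃ E : Set ℝ, (∀ᵐ t ∂(μ α), t ∈ E) ∧ AntitoneOn (invSlopeFun f w s) E ∧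
      ∀ t ∈ E, 0 ≤ invSlopeFun f w s t := by
  have hP := h.isPrimitivePair hw
  set E₁ : Set ℝ := {t | t ∈ Ioo 0 s ∧ t ∈ D ∧ 0 < f t ∧
    ((lo (prim f s) (prim w s) s (levelSlope f w s t) < t ∧
      t < hi (prim f s) (prim w s) s (levelSlope f w s t)) ∨
      f t = levelSlope f w s t * w t)} with hE₁
  set E₂ : Set ℝ := {t | t ∈ I α \ {0} ∧ s ≤ t} with hE₂
  refine ⟨E₁ ∪ E₂, ?_, ?_, ?_⟩
  · filter_upwards [ae_mem_I_diff_zero (α := α), ae_restrict_of_ae hD,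
      ae_restrict_of_ae (h.ae_eq_levelSlope_mul hw),
      ae_restrict_of_ae ((ae_restrict_iff' measurableSet_Ioo).1 h.posIntegrable.pos)]
      with t h1 h2 h3 h4
    by_cases hts : s ≤ t
    · exact Or.inr ⟨h1, hts⟩
    · have ht : t ∈ Ioo 0 s := ⟨lt_of_le_of_ne h1.1.1 (Ne.symm h1.2), not_le.1 hts⟩
      exact Or.inl ⟨ht, h2 ht, h4 ht, (h3 ht).imp_right And.right⟩
  · intro t ht t' ht' htt'
    rcases ht with ⟨hts, htD, -, hor⟩ | ⟨htI, hts⟩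
    · rw [invSlopeFun_of_mem hts]
      obtain ⟨hl, -, -⟩ := hP.majSlope_spec hts
      rcases ht' with ⟨hts', htD', -, hor'⟩ | ⟨htI', hts'⟩
      · rw [invSlopeFun_of_mem hts']
        rcases (hP.majSlope_antitoneOn hts hts' htt').eq_or_lt with heq | hlt
        · change levelSlope f w s t' = levelSlope f w s t at heq
          rw [heq]
          exact div_le_div_of_nonneg_right (hf htD htD' htt') hl.le
        -- The slope drops strictly from `t` to `t'`, so the value of `w` at the right end `hi` for
        -- the slope of `t` lies between the two quotients.
        · have hs := hts.1.trans hts.2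
          have hle := hP.hi_le_lo_of_lt hs hlt
          have h0 : 0 < hi (prim f s) (prim w s) s (levelSlope f w s t) :=
            hts.1.trans_le (hP.majSlope_spec hts).2.2
          have hlt' := (hle.trans (hP.majSlope_spec hts').2.1).trans_lt hts'.2
          exact (h.div_levelSlope_le_w hw hD hf hts' htD' (hor'.imp_left And.left) h0 hle).trans
            (h.w_le_div_levelSlope hw hD hf hts htD (hor.imp_left And.right)
              (Ioo_subset_I h.le ⟨h0, hlt'⟩) le_rfl)
      · rw [invSlopeFun_of_notMem fun hh => absurd hts' (not_le.2 hh.2)]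
        exact h.w_le_div_levelSlope hw hD hf hts htD (hor.imp_left And.right) htI'.1
          ((hP.hi_mem (hts.1.trans hts.2) _).1.2.trans hts')
    · rcases ht' with ⟨hts', -⟩ | ⟨htI', hts'⟩
      · exact absurd (hts.trans htt') (not_le.2 hts'.2)
      · rw [invSlopeFun_of_notMem fun hh => absurd hts (not_le.2 hh.2),
          invSlopeFun_of_notMem fun hh => absurd hts' (not_le.2 hh.2)]
        exact hw.antitoneOn htI htI' htt'
  · rintro t (⟨hts, -, h0, -⟩ | ⟨htI, hts⟩)
    · rw [invSlopeFun_of_mem hts]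
      exact div_nonneg h0.le (h.levelSlope_pos hw hts).le
    · rw [invSlopeFun_of_notMem fun hh => absurd hts (not_le.2 hh.2)]
      exact (hw.pos t htI.1 htI.2).le

/-- Split at the smallest maximizer `a` for the slope `l` at `t`. Left of `a` the integrals of `f /
h` and `w` agree; on `(a, t)` the slope is `l`, and `F t - F a ≤ l (W t - W a)` because `a` is a
maximizer. -/
lemma lintegral_div_levelSlope_le (h : BoundedSupport α f s) (hw : IsWeight α w) {t : ℝ}
    (ht : t ∈ Ioo 0 s) : intg (invSlopeFun f w s) 0 t ≤ intg w 0 t := by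
  have hP := h.isPrimitivePair hw
  have hs := ht.1.trans ht.2
  have hwi := hw.posIntegrable h.le
  obtain ⟨hl, h1, h2⟩ := hP.majSlope_spec ht
  set l := majSlope (prim f s) (prim w s) s t with hl_def
  set a := lo (prim f s) (prim w s) s l with ha
  have haI : a ∈ Icc 0 s := (hP.lo_mem hs l).1
  have hval : ∀ x ∈ Ioo a t, levelSlope f w s x = l := fun x hx =>
    hP.majSlope_eq ⟨haI.1.trans_lt hx.1, hx.2.trans ht.2⟩ hx.1 (hx.2.trans_le h2)
  have hlt_iff : ∀ᵐ x, x ∈ Ioo 0 s → (l < levelSlope f w s x ↔ x ∈ Ioo 0 a) := by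
    filter_upwards [Measure.ae_ne volume a] with x hxa hx
    obtain ⟨-, h3, h4⟩ := hP.majSlope_spec hx
    constructor
    · intro hlx
      exact ⟨hx.1, lt_of_le_of_ne (h4.trans (hP.hi_le_lo_of_lt hs hlx)) hxa⟩
    · intro hxa'
      refine lt_of_le_of_ne (hP.majSlope_antitoneOn hx ht (hxa'.2.le.trans h1)) fun heq => ?_
      change l = majSlope (prim f s) (prim w s) s x at heq
      rw [← heq] at h3
      exact absurd hxa'.2 (not_lt.2 h3)
  have hleft : intg (invSlopeFun f w s) 0 a = intg w 0 a := by
    -- Up to a null set `(0, a)` is where the slope exceeds `l`. Restriction to it is thus a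
    -- function of the slope, and the main identity applies with `k(y) = 1/y` for `y > l` and `0`
    -- otherwise.
    have key : ∀ u v : ℝ → ℝ, (∀ x ∈ Ioo 0 s,
        ENNReal.ofReal (levelSlope f w s x)⁻¹ * ENNReal.ofReal (u x) = ENNReal.ofReal (v x)) →
        ∫⁻ x in Ioo 0 s, (Ioi l).indicator (fun y => ENNReal.ofReal y⁻¹) (levelSlope f w s x) *
          ENNReal.ofReal (u x) = intg v 0 a := by
      intro u v huv
      have hsub : Ioo 0 a ⊆ Ioo 0 s := Ioo_subset_Ioo_right haI.2
      rw [intg, ← inter_eq_self_of_subset_left hsub, ← setLIntegral_indicator measurableSet_Ioo]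
      refine setLIntegral_congr_fun_ae measurableSet_Ioo ?_
      filter_upwards [hlt_iff] with x hx hxs
      by_cases hxa : x ∈ Ioo 0 a
      · rw [indicator_of_mem (mem_Ioi.2 ((hx hxs).2 hxa)), indicator_of_mem hxa, huv x hxs]
      · rw [indicator_of_notMem (s := Ioi l) fun hh => hxa ((hx hxs).1 hh),
          indicator_of_notMem hxa, zero_mul]
    rw [← key f (invSlopeFun f w s), h.lintegral_levelSlope_mul hw, key]
    · intro x hx
      have hlx := h.levelSlope_pos hw hx
      rw [← ENNReal.ofReal_mul (inv_nonneg.2 hlx.le), inv_mul_cancel_left₀ hlx.ne']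
    · intro x hx
      rw [← ENNReal.ofReal_mul (inv_nonneg.2 (h.levelSlope_pos hw hx).le), invSlopeFun_of_mem hx,
        div_eq_inv_mul]
  have hright : intg (invSlopeFun f w s) a t ≤ intg w a t := by
    have e1 : intg (invSlopeFun f w s) a t
        = ∫⁻ x in Ioo a t, ENNReal.ofReal l⁻¹ * ENNReal.ofReal (f x) := by
      refine setLIntegral_congr_fun measurableSet_Ioo fun x hx => ?_
      rw [invSlopeFun_of_mem ⟨haI.1.trans_lt hx.1, hx.2.trans ht.2⟩, hval x hx, div_eq_inv_mul,
        ENNReal.ofReal_mul (inv_nonneg.2 hl.le)]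
    rw [e1, lintegral_const_mul' _ _ ENNReal.ofReal_ne_top]
    change _ * intg f a t ≤ _
    rw [h.posIntegrable.intg_eq haI.1 h1 ht.2.le, hwi.intg_eq haI.1 h1 ht.2.le,
      ← ENNReal.ofReal_mul (inv_nonneg.2 hl.le)]
    refine ENNReal.ofReal_le_ofReal ?_
    rw [inv_mul_le_iff₀ hl]
    exact hP.sub_lo_le hs l ⟨ht.1.le, ht.2.le⟩
  rw [intg_add haI.1 h1, intg_add (u := w) haI.1 h1, hleft]
  exact add_le_add_right hright _

lemma intg_invSlopeFun_le (h : BoundedSupport α f s) (hw : IsWeight α w) {t : ℝ} (ht : 0 ≤ t) :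
    intg (invSlopeFun f w s) 0 t ≤ intg w 0 t := by
  rcases ht.eq_or_lt with rfl | ht0
  · simp [intg]
  rcases lt_or_ge t s with hts | hts
  · exact h.lintegral_div_levelSlope_le hw ⟨ht0, hts⟩
  · rw [intg_add h.nonneg hts, intg_add (u := w) h.nonneg hts]
    refine add_le_add (setLIntegral_Ioo_le_of_forall_lt fun t ht =>
      h.lintegral_div_levelSlope_le hw ht) (setLIntegral_mono' measurableSet_Ioo fun x hx => ?_)
    rw [invSlopeFun_of_notMem fun hh => absurd hx.1 (not_lt.2 hh.2.le)]

/-- Being decreasing on a set of full measure, the function can stand in for its rearrangement, and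
the comparison of primitives suffices. -/
lemma submaj_invSlopeFun (h : BoundedSupport α f s) (hw : IsWeight α w) {D : Set ℝ}
    (hD : ∀ᵐ t, t ∈ Ioo 0 s → t ∈ D) (hf : AntitoneOn f D) : Submaj α (invSlopeFun f w s) w := by
  intro t ht
  obtain ⟨E, hE, hanti, hpos⟩ := h.exists_antitoneOn_invSlopeFun hw hD hf
  calc ∫⁻ x in Ioo 0 t, rearr α (invSlopeFun f w s) x
      ≤ intg (invSlopeFun f w s) 0 t :=
        lintegral_rearr_le_of_antitoneOn (h.invSlopeFun_mem_L0 hw) hE hanti hpos ht.2.le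
    _ ≤ intg w 0 t := h.intg_invSlopeFun_le hw ht.1
    _ ≤ ∫⁻ x in Ioo 0 t, ENNReal.ofReal |w x| :=
        lintegral_mono fun x => ENNReal.ofReal_le_ofReal (le_abs_self _)
    _ ≤ _ := lintegral_abs_le_lintegral_rearr hw.mem_L0 ht.2.le

/-! ### The modular -/

lemma lintegral_eq_setLIntegral_Ioo (h : BoundedSupport α f s) {G : ℝ → ℝ≥0∞}
    (hG : ∀ᵐ t, t ∈ I α → t ∉ Ioo 0 s → t ≠ 0 → G t = 0) :
    ∫⁻ t, G t ∂(μ α) = ∫⁻ t in Ioo 0 s, G t := by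
  rw [μ, ← lintegral_inter_add_sdiff G (I α) measurableSet_Ioo,
    inter_eq_self_of_subset_right (Ioo_subset_I h.le)]
  have : ∫⁻ t in I α \ Ioo 0 s, G t = ∫⁻ _ in I α \ Ioo 0 s, 0 := by
    refine setLIntegral_congr_fun_ae ((measurableSet_I α).diff measurableSet_Ioo) ?_
    filter_upwards [hG, Measure.ae_ne volume (0 : ℝ)] with t ht ht0 htm
    exact ht htm.1 htm.2 ht0
  rw [this, lintegral_zero, add_zero]

lemma lintegral_persp_levelFun (h : BoundedSupport α f s) (hφ : IsOrlicz φ) (hw : IsWeight α w) :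
    ∫⁻ t, persp φ (levelFun α f w t) (ENNReal.ofReal (w t)) ∂(μ α)
      = ∫⁻ t in Ioo 0 s, ENNReal.ofReal (φ (levelSlope f w s t)) * ENNReal.ofReal (w t) := by
  rw [h.lintegral_eq_setLIntegral_Ioo]
  · refine setLIntegral_congr_fun_ae measurableSet_Ioo ?_
    filter_upwards [h.levelFun_ae_eq hw] with t ht hts
    have hwt := hw.pos t (Ioo_subset_I h.le hts) hts.1.ne'
    rw [(ht hts).1, persp_ofReal (mul_nonneg (h.levelSlope_pos hw hts).le hwt.le) hwt,
      mul_div_cancel_right₀ _ hwt.ne']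
  · filter_upwards [h.zero] with t ht htI hts ht0
    rw [(h.levelFun_of_notMem hw hts).1, ht htI hts, persp_ofReal le_rfl (hw.pos t htI ht0),
      zero_div, hφ.zero, ENNReal.ofReal_zero, zero_mul]

lemma lintegral_persp_invLevelFun (h : BoundedSupport α f s) (hφ : IsOrlicz φ)
    (hw : IsWeight α w) :
    ∫⁻ t, persp φ (ENNReal.ofReal (f t)) (invLevelFun α f w t) ∂(μ α)
      = ∫⁻ t in Ioo 0 s, ENNReal.ofReal (φ (levelSlope f w s t)) * ENNReal.ofReal (w t) := by
  rw [h.lintegral_eq_setLIntegral_Ioo]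
  -- Since `f / (f / l) = l`, the integrand is `φ(l) l⁻¹ f`, whence this choice of `k`.
  · have h1 := h.lintegral_levelSlope_mul hw fun l => ENNReal.ofReal (φ l) * ENNReal.ofReal l⁻¹
    have h2 : ∫⁻ t in Ioo 0 s, persp φ (ENNReal.ofReal (f t)) (invLevelFun α f w t)
        = ∫⁻ t in Ioo 0 s, ENNReal.ofReal (φ (levelSlope f w s t)) *
          ENNReal.ofReal (levelSlope f w s t)⁻¹ * ENNReal.ofReal (f t) := by
      refine setLIntegral_congr_fun_ae measurableSet_Ioo ?_
      filter_upwards [h.levelFun_ae_eq hw,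
        (ae_restrict_iff' measurableSet_Ioo).1 h.posIntegrable.pos] with t ht hft hts
      have hl := h.levelSlope_pos hw hts
      have hf := hft hts
      rw [(ht hts).2, persp_ofReal hf.le (div_pos hf hl), div_div_cancel₀ hf.ne', mul_assoc,
        ← ENNReal.ofReal_mul (inv_nonneg.2 hl.le), div_eq_inv_mul]
    rw [h2, h1]
    refine setLIntegral_congr_fun measurableSet_Ioo fun t hts => ?_
    have hl := h.levelSlope_pos hw hts
    change _ * _ * ENNReal.ofReal (levelSlope f w s t * w t) = _
    rw [mul_assoc, ← ENNReal.ofReal_mul (inv_nonneg.2 hl.le), inv_mul_cancel_left₀ hl.ne']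
  · filter_upwards [h.zero] with t ht htI hts ht0
    rw [(h.levelFun_of_notMem hw hts).2, ht htI hts, persp_ofReal le_rfl (hw.pos t htI ht0),
      zero_div, hφ.zero, ENNReal.ofReal_zero, zero_mul]

lemma P_eq (h : BoundedSupport α f s) (hφ : IsOrlicz φ) (hw : IsWeight α w)
    (hf : ∀ᵐ t ∂(μ α), 0 ≤ f t ∧ ENNReal.ofReal (f t) = rearr α f t) :
    P α φ w f
      = ∫⁻ t in Ioo 0 s, ENNReal.ofReal (φ (levelSlope f w s t)) * ENNReal.ofReal (w t) := by
  refine le_antisymm ?_ (le_iInf₂ fun g hg => ?_)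
  -- `f` agrees with its rearrangement only a.e., so its monotonicity is available only on this set
  -- of full measure.
  · have hD : ∀ᵐ t, t ∈ Ioo 0 s → t ∈ {t | 0 ≤ f t ∧ ENNReal.ofReal (f t) = rearr α f t} := by
      filter_upwards [(ae_restrict_iff' (measurableSet_I α)).1 hf] with t ht hts
      exact ht (Ioo_subset_I h.le hts)
    have hanti : AntitoneOn f {t | 0 ≤ f t ∧ ENNReal.ofReal (f t) = rearr α f t} := by
      rintro x ⟨hx, hxe⟩ y ⟨hy, hye⟩ hxy
      rw [← ENNReal.ofReal_le_ofReal_iff hx, hxe, hye]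
      exact rearr_antitone α f hxy
    rw [← h.lintegral_persp_invLevelFun hφ hw]
    refine (iInf₂_le (invSlopeFun f w s)
      ⟨h.invSlopeFun_mem_L0 hw, h.submaj_invSlopeFun hw hD hanti⟩).trans_eq (lintegral_congr_ae ?_)
    filter_upwards [hf, ae_restrict_of_ae (h.levelFun_ae_eq hw), ae_mem_I_diff_zero (α := α)]
      with t h1 h2 h3
    rw [← h1.2]
    congr 1
    by_cases hts : t ∈ Ioo 0 s
    · rw [(h2 hts).2, invSlopeFun_of_mem hts,
        abs_of_nonneg (div_nonneg h1.1 (h.levelSlope_pos hw hts).le)]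
    · rw [(h.levelFun_of_notMem hw hts).2, invSlopeFun_of_notMem hts,
        abs_of_pos (hw.pos t h3.1 h3.2)]
  · refine (h.lintegral_le_lintegral_persp hφ hw hg.1 fun t ht =>
      hg.2.lintegral_abs_le hw hg.1 (Ioo_subset_I h.le ht)).trans ?_
    have h1 : ∫⁻ t in Ioo 0 s, persp φ (ENNReal.ofReal (f t)) (ENNReal.ofReal |g t|)
        = ∫⁻ t in Ioo 0 s, persp φ (rearr α f t) (ENNReal.ofReal |g t|) := by
      refine lintegral_congr_ae ?_
      filter_upwards [ae_mono (restrict_Ioo_le h.le) hf] with t ht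
      rw [ht.2]
    rw [h1]
    exact lintegral_mono' (restrict_Ioo_le h.le) le_rfl

lemma of_support {α : EReal} (hα : 0 < α) (hφ : IsOrlicz φ) (hw : IsWeight α w)
    (hf : f ∈ M α φ w) (hf_nonneg : ∀ᵐ t ∂(μ α), 0 ≤ f t) (hs : 0 ≤ s)
    (hsupp : ({t | t ∈ I α ∧ f t ≠ 0} : Set ℝ) =ᵐ[volume] Ioo 0 s) : BoundedSupport α f s := by
  have hiff : ∀ᵐ t, (t ∈ I α ∧ f t ≠ 0) ↔ t ∈ Ioo 0 s := by
    filter_upwards [hsupp] with t ht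
    exact Iff.of_eq ht
  have hle : (s : EReal) ≤ α := by
    -- If `α < s`, then `(α, s)` would be a.e. contained in `I`; a set of full measure is dense,
    -- hence has a point strictly between `q > α` and `s`.
    by_contra! hlt
    obtain ⟨q, hq, hqs⟩ := EReal.lt_iff_exists_real_btwn.1 hlt
    have hq0 : (0 : ℝ) < q := by exact_mod_cast hα.trans hq
    obtain ⟨x, hx, hqx, hxs⟩ :=
      (Measure.dense_of_ae hiff).exists_between (EReal.coe_lt_coe_iff.1 hqs)
    have hxI := (hx.2 ⟨hq0.trans hqx, hxs⟩).1.2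
    exact absurd (hq.trans (EReal.coe_lt_coe_iff.2 hqx)) (not_lt.2 hxI.le)
  refine ⟨hs, hle, ⟨AEMeasurable.mono_measure hf.1 (restrict_Ioo_le hle), ?_,
    intg_lt_top_of_mem_M hφ hw hf hle⟩, ?_⟩
  · filter_upwards [ae_mono (restrict_Ioo_le hle) hf_nonneg, ae_restrict_of_ae hiff,
      ae_restrict_mem measurableSet_Ioo] with t h1 h2 h3
    exact lt_of_le_of_ne h1 (Ne.symm (h2.2 h3).2)
  · filter_upwards [hiff] with t ht htI hts
    by_contra hne
    exact hts (ht.1 ⟨htI, hne⟩)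

end BoundedSupport

end OrliczLorentz

end

theorem mainTheorem8 (α : EReal) (hα : 0 < α)
    (φ : ℝ → ℝ) (hφ : OrliczLorentz.IsNFunction φ)
    (w : ℝ → ℝ) (hw : OrliczLorentz.IsWeight α w)
    (f : ℝ → ℝ) (hf : f ∈ OrliczLorentz.M α φ w)
    (hf_rearr : ∀ᵐ t ∂(OrliczLorentz.μ α),
      0 ≤ f t ∧ ENNReal.ofReal (f t) = OrliczLorentz.rearr α f t)
    (s : ℝ) (hs : 0 ≤ s)
    (hsupp : ({t | t ∈ OrliczLorentz.I α ∧ f t ≠ 0} : Set ℝ) =ᵐ[volume] Ioo 0 s) :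
    OrliczLorentz.P α φ w f
        = ∫⁻ t, OrliczLorentz.persp φ (OrliczLorentz.levelFun α f w t)
            (ENNReal.ofReal (w t)) ∂(OrliczLorentz.μ α) ∧
      OrliczLorentz.P α φ w f
        = ∫⁻ t, OrliczLorentz.persp φ (ENNReal.ofReal (f t))
            (OrliczLorentz.invLevelFun α f w t) ∂(OrliczLorentz.μ α) := by
  have h := OrliczLorentz.BoundedSupport.of_support hα hφ.toIsOrlicz hw hf
    (hf_rearr.mono fun _ ht => ht.1) hs hsupp
  rw [h.P_eq hφ.toIsOrlicz hw hf_rearr, h.lintegral_persp_levelFun hφ.toIsOrlicz hw,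
    h.lintegral_persp_invLevelFun hφ.toIsOrlicz hw]
  exact ⟨rfl, rfl⟩
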